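/- Let $F$ be a field of characteristic different from $2$ (for instance a local field of odd or zero characteristic), let $E/F$ be a quadratic field extension with nontrivial automorphism $c$, and let $W_1$, $W_2$ be non-degenerate Hermitian spaces over $E$ (with respect to $c$) of the same finite dimension $d$. Put $W=W_1\oplus W_2$ (orthogonal sum), let $\sigma(w_1+w_2)=w_1-w_2$, and let $\mathfrak u(W)=\{x\in\mathrm{End}_E(W):\langle xu,v\rangle+\langle u,xv\rangle=0\}$. Let $\mathfrak u(W)_1$ be the $(-1)$-eigenspace of $x\mapsto\sigma x\sigma$ on $\mathfrak u(W)$; its elements are uniquely of the form $$\delta(X)=\begin{pmatrix}0&X\\-X^*&0\end{pmatrix},\qquad X\in\mathrm{Hom}_E(W_2,W_1),\qquad \langle Xv,w\rangle_1=\langle v,X^*w\rangle_2 .$$ Let $\mathcal{H}erm(W_1)=\{x\in\mathrm{End}_E(W_1):\langle xu,v\rangle_1=\langle u,xv\rangle_1\}$. Regard $\mathfrak u(W)_1$ and $\mathcal{H}erm(W_1)$ as affine spaces over $F$ and the unitary groups $U(W_1)$, $U(W_2)$ as group functors on commutative $F$-algebras, with $U(W_1)\times U(W_2)\subset U(W)$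 acting on $\mathfrak u(W)_1$ by the restriction of the adjoint action. Let $r:\mathfrak u(W)_1\to\mathcal{H}erm(W_1)$ be the $F$-morphism given on points by $r(\delta(X))=-XX^*$. Then: 1. $r$ intertwines the action of $U(W_1)$ on $\mathfrak u(W)_1$ with the adjoint action of $U(W_1)$ on $\mathcal{H}erm(W_1)$: for every commutative $F$-algebra $R$, every $g\in U(W_1)(R)$ and every $R$-point $x$ of $\mathfrak u(W)_1$, one has $r(g\cdot x)=g\,r(x)\,g^{-1}$. 2. $(\mathcal{H}erm(W_1),r)$ is a categorical quotient of $\mathfrak u(W)_1$ by $U(W_2)$: the morphism $r$ is $U(W_2)$-invariant, and for every separated $F$-scheme $Z$ and every $U(W_2)$-invariant $F$-morphism $f:\mathfrak u(W)_1\to Z$ there is a unique $F$-morphism $\bar f:\mathcal{H}erm(W_1)\to Z$ with $f=\bar f\circ r$. (A morphism $f$ is called $U(W_2)$-invariant if $f(h\cdot x)=f(x)$ for every commutative $F$-algebra $R$, every $h\in U(W_2)(R)$ and every $R$-point $x$.) -/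

import Mathlib

open CategoryTheory AlgebraicGeometry
open scoped TensorProduct

universe u

set_option linter.unusedSectionVars false

namespace UnitarySymmetricPair

/-! ### Affine spaces, their points, and categorical quotients over a field -/

section Schemes

variable (F : Type u) [Field F]

/-- `Spec R` as a scheme over `F`, for a commutative `F`-algebra `R`. -/
noncomputable def specOver (R : Type u) [CommRing R] [Algebra F R] :
    Over (Spec (CommRingCat.of F)) :=
  Over.mk (Spec.map (CommRingCat.ofHom (algebraMap F R)))

/-- A finite-dimensional vector space `V` as an affine space over `F`: the spectrum of the
symmetric algebra of the dual of `V`. -/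
noncomputable abbrev affineSpace (V : Type u) [AddCommGroup V] [Module F V] :
    Over (Spec (CommRingCat.of F)) :=
  specOver F (SymmetricAlgebra F (Module.Dual F V))

variable {F}

/-- The morphism `Spec S ⟶ Spec R` over `F` given by an `F`-algebra map `R → S`. -/
noncomputable def specOverMap {R S : Type u} [CommRing R] [Algebra F R] [CommRing S] [Algebra F S]
    (φ : R →ₐ[F] S) : specOver F S ⟶ specOver F R :=
  Over.homMk (Spec.map (CommRingCat.ofHom φ.toRingHom)) (by
    simp only [specOver, Over.mk_left, Over.mk_hom, ← Spec.map_comp, ← CommRingCat.ofHom_comp]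
    congr 2
    exact φ.comp_algebraMap)

theorem specOverMap_bijective {R S : Type u} [CommRing R] [Algebra F R] [CommRing S]
    [Algebra F S] :
    Function.Bijective (specOverMap : (R →ₐ[F] S) → (specOver F S ⟶ specOver F R)) := by
  constructor
  · intro φ ψ h
    have h1 : Spec.map (CommRingCat.ofHom φ.toRingHom) =
        Spec.map (CommRingCat.ofHom ψ.toRingHom) := congrArg (fun f => f.left) h
    have h2 := congrArg CommRingCat.Hom.hom (Spec.map_injective h1)
    ext x
    exact congrArg (fun f : R →+* S => f x) h2
  · intro f
    obtain ⟨g, hg⟩ := Spec.map_surjective (R := CommRingCat.of R) (S := CommRingCat.of S) f.left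
    have hw := Over.w f
    have hw' : Spec.map g ≫ Spec.map (CommRingCat.ofHom (algebraMap F R)) =
        Spec.map (CommRingCat.ofHom (algebraMap F S)) := by
      rw [hg]; exact hw
    rw [← Spec.map_comp] at hw'
    have h2 := congrArg CommRingCat.Hom.hom (Spec.map_injective hw')
    refine ⟨{ toRingHom := g.hom
              commutes' := fun r => congrArg (fun f : F →+* S => f r) h2 }, ?_⟩
    apply Over.OverMorphism.ext
    exact hg

theorem specOverMap_comp {R S T : Type u} [CommRing R] [Algebra F R] [CommRing S] [Algebra F S]
    [CommRing T] [Algebra F T] (φ : R →ₐ[F] S) (ψ : S →ₐ[F] T) :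
    specOverMap (ψ.comp φ) = specOverMap ψ ≫ specOverMap φ := by
  apply Over.OverMorphism.ext
  exact (Spec.map_comp (CommRingCat.ofHom φ.toRingHom) (CommRingCat.ofHom ψ.toRingHom))

section Points

variable {V : Type u} [AddCommGroup V] [Module F V]
variable (R : Type u) [CommRing R] [Algebra F R]

/-- Evaluation of linear forms: `r ⊗ v` is sent to the linear map `ℓ ↦ ℓ(v) r`. -/
noncomputable def evalForms : R ⊗[F] V →ₗ[F] (Module.Dual F V →ₗ[F] R) :=
  TensorProduct.lift
    (LinearMap.mk₂ F (fun r v => (LinearMap.toSpanSingleton F R r).comp (Module.Dual.eval F V v))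
      (by intros; ext; simp) (by intros; ext; simpa using smul_comm _ _ _)
      (by intros; ext; simp [add_smul]) (by intros; ext; simp [mul_smul]))

@[simp]
theorem evalForms_tmul (r : R) (v : V) (l : Module.Dual F V) :
    evalForms R (r ⊗ₜ[F] v) l = l v • r := by
  simp [evalForms]

theorem evalForms_bijective [FiniteDimensional F V] :
    Function.Bijective (evalForms (F := F) (V := V) R) := by
  let b := Module.finBasis F V
  have hinj : ∀ x : R ⊗[F] V, x = ∑ i, evalForms R x (b.coord i) ⊗ₜ[F] b i := by
    intro x
    induction x with
    | zero => simp
    | add x y hx hy =>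
      simp only [map_add, LinearMap.add_apply, TensorProduct.add_tmul, Finset.sum_add_distrib]
      rw [← hx, ← hy]
    | tmul r v =>
      simp only [evalForms_tmul, TensorProduct.smul_tmul, ← TensorProduct.tmul_sum]
      congr 1
      simp [b.sum_repr v]
  constructor
  · intro x y h
    rw [hinj x, hinj y, h]
  · intro f
    refine ⟨∑ i, f (b.coord i) ⊗ₜ[F] b i, ?_⟩
    apply b.dualBasis.ext
    intro j
    simp [Finsupp.single_apply, LinearMap.sum_apply]

/-- The `R`-points of the affine space of `V` are the elements of `R ⊗ V`. -/
noncomputable def points [FiniteDimensional F V] :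
    R ⊗[F] V ≃ (specOver F R ⟶ affineSpace F V) :=
  ((Equiv.ofBijective _ (evalForms_bijective (F := F) (V := V) R)).trans
    SymmetricAlgebra.lift).trans (Equiv.ofBijective _ specOverMap_bijective)

/-- The element of `R ⊗ V` obtained from an element of `S ⊗ V` by extension of scalars
along `S → R`. -/
noncomputable def mapScalars {R} {S : Type u} [CommRing R] [Algebra F R] [CommRing S] [Algebra F S]
    (φ : S →ₐ[F] R) (M : Type u) [AddCommMonoid M] [Module F M] : S ⊗[F] M →ₗ[F] R ⊗[F] M :=
  φ.toLinearMap.rTensor M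

theorem mapScalars_baseChange {R} {S : Type u} [CommRing R] [Algebra F R] [CommRing S]
    [Algebra F S] (φ : S →ₐ[F] R) {M N : Type u} [AddCommMonoid M] [Module F M] [AddCommMonoid N]
    [Module F N] (L : M →ₗ[F] N) (y : S ⊗[F] M) :
    mapScalars φ N (L.baseChange S y) = L.baseChange R (mapScalars φ M y) := by
  induction y with
  | zero => simp
  | add x y hx hy => simp only [map_add, hx, hy]
  | tmul s m => simp [mapScalars]

theorem points_mapScalars [FiniteDimensional F V] {S : Type u} [CommRing S] [Algebra F S]
    (φ : S →ₐ[F] R) (x : S ⊗[F] V) :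
    points R (mapScalars φ V x) = specOverMap φ ≫ points S x := by
  have h0 : ∀ l, evalForms R (mapScalars φ V x) l = φ (evalForms S x l) := by
    intro l
    induction x with
    | zero => simp
    | add x y hx hy => simp only [map_add, LinearMap.add_apply, hx, hy]
    | tmul s v => simp [mapScalars]
  have h : SymmetricAlgebra.lift (evalForms R (mapScalars φ V x)) =
      φ.comp (SymmetricAlgebra.lift (evalForms S x)) := by
    apply SymmetricAlgebra.algHom_ext
    apply LinearMap.ext
    intro l
    change SymmetricAlgebra.lift _ (SymmetricAlgebra.ι F _ l) =
      φ (SymmetricAlgebra.lift _ (SymmetricAlgebra.ι F _ l))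
    rw [SymmetricAlgebra.lift_ι_apply, SymmetricAlgebra.lift_ι_apply, h0]
  change specOverMap (SymmetricAlgebra.lift (evalForms R (mapScalars φ V x))) =
    specOverMap φ ≫ specOverMap (SymmetricAlgebra.lift (evalForms S x))
  rw [← specOverMap_comp, ← h]

variable (F V) in
/-- The generic point of the affine space of `V`: the point which corresponds to the identity. -/
noncomputable def genericPoint [FiniteDimensional F V] :
    SymmetricAlgebra F (Module.Dual F V) ⊗[F] V :=
  (points _).symm (𝟙 (affineSpace F V))

theorem points_genericPoint [FiniteDimensional F V] :
    points _ (genericPoint F V) = 𝟙 (affineSpace F V) :=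
  Equiv.apply_symm_apply _ _

/-- The morphism of affine spaces given by a family of maps `R ⊗ V → R ⊗ V'`, one for each
commutative `F`-algebra `R`: the image of the generic point. If the family is natural in `R`,
the morphism induces the given maps on `R`-points (`points_ofPointMaps`). -/
noncomputable def ofPointMaps [FiniteDimensional F V] {V' : Type u} [AddCommGroup V']
    [Module F V'] [FiniteDimensional F V']
    (t : ∀ (R : Type u) [CommRing R] [Algebra F R], R ⊗[F] V → R ⊗[F] V') :
    affineSpace F V ⟶ affineSpace F V' :=
  points _ (t _ (genericPoint F V))

theorem points_ofPointMaps [FiniteDimensional F V] {V' : Type u} [AddCommGroup V']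
    [Module F V'] [FiniteDimensional F V']
    (t : ∀ (R : Type u) [CommRing R] [Algebra F R], R ⊗[F] V → R ⊗[F] V')
    (ht : ∀ (R S : Type u) [CommRing R] [Algebra F R] [CommRing S] [Algebra F S]
      (φ : S →ₐ[F] R) (x : S ⊗[F] V), mapScalars φ V' (t S x) = t R (mapScalars φ V x))
    (x : R ⊗[F] V) :
    points R x ≫ ofPointMaps t = points R (t R x) := by
  obtain ⟨φ, hφ⟩ := specOverMap_bijective.2 (points R x)
  have hx : mapScalars φ V (genericPoint F V) = x := by
    apply (points R).injective
    rw [points_mapScalars, points_genericPoint, hφ]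
    exact Category.comp_id _
  rw [← hφ]
  change specOverMap φ ≫ points _ _ = _
  rw [← points_mapScalars, ht, hx]

end Points

variable {G : ∀ (R : Type u) [CommRing R] [Algebra F R], Type u}
  {X Q : Over (Spec (CommRingCat.of F))}

/-- A morphism `f : X ⟶ Z` over `F` is invariant under the action of a group functor `G` on `X`
if `f(g • x) = f(x)` for all commutative `F`-algebras `R`, `g ∈ G(R)` and `x ∈ X(R)`. -/
def IsInvariant
    (act : ∀ (R : Type u) [CommRing R] [Algebra F R],
      G R → (specOver F R ⟶ X) → (specOver F R ⟶ X))
    {Z : Over (Spec (CommRingCat.of F))} (f : X ⟶ Z) : Prop :=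
  ∀ (R : Type u) [CommRing R] [Algebra F R] (g : G R) (x : specOver F R ⟶ X),
    act R g x ≫ f = x ≫ f

/-- `(Q, π)` is a categorical quotient of `X` by `G`: the morphism `π` is invariant, and every
invariant morphism from `X` to a separated `F`-scheme factors uniquely through `π`. -/
def IsCategoricalQuotient
    (act : ∀ (R : Type u) [CommRing R] [Algebra F R],
      G R → (specOver F R ⟶ X) → (specOver F R ⟶ X))
    (π : X ⟶ Q) : Prop :=
  IsInvariant act π ∧
    ∀ (Z : Over (Spec (CommRingCat.of F))) [IsSeparated Z.hom] (f : X ⟶ Z),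
      IsInvariant act f → ∃! g : Q ⟶ Z, π ≫ g = f

end Schemes

/-! ### Hermitian spaces, adjoints, unitary groups -/

section Hermitian

variable {F E : Type u} [Field F] [Field E] [Algebra F E]

/-- A (non-degenerate) Hermitian form on the `E`-vector space `W`, where `c` is the conjugation
of `E` over `F`. -/
structure HermForm (c : E ≃ₐ[F] E) (W : Type u) [AddCommGroup W] [Module E W] where
  form : W →ₗ[E] W →ₛₗ[(c : E →+* E)] E
  symm : ∀ v w, form w v = c (form v w)
  nondeg : ∀ v, (∀ w, form v w = 0) → v = 0

namespace HermForm

variable {c : E ≃ₐ[F] E}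
variable {W₁ : Type u} [AddCommGroup W₁] [Module E W₁]
variable {W₂ : Type u} [AddCommGroup W₂] [Module E W₂]
variable {W₃ : Type u} [AddCommGroup W₃] [Module E W₃]

theorem form_smul_left [Module F W₁] [IsScalarTower F E W₁] (h : HermForm c W₁) (a : F)
    (v w : W₁) : h.form (a • v) w = algebraMap F E a * h.form v w := by
  rw [← algebraMap_smul E a v, map_smul, LinearMap.smul_apply, smul_eq_mul]

theorem form_smul_right [Module F W₁] [IsScalarTower F E W₁] (h : HermForm c W₁) (a : F)
    (v w : W₁) : h.form v (a • w) = algebraMap F E a * h.form v w := by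
  rw [← algebraMap_smul E a w, map_smulₛₗ]
  simp

theorem ext_right (h : HermForm c W₁) {w w' : W₁} (H : ∀ v, h.form v w = h.form v w') :
    w = w' := by
  rw [← sub_eq_zero]
  apply h.nondeg
  intro v
  rw [h.symm v, map_sub, H v, sub_self, map_zero]

/-- The orthogonal sum of two Hermitian spaces. -/
def prod (h₁ : HermForm c W₁) (h₂ : HermForm c W₂) : HermForm c (W₁ × W₂) where
  form := LinearMap.mk₂'ₛₗ (RingHom.id E) (c : E →+* E)
    (fun v w => h₁.form v.1 w.1 + h₂.form v.2 w.2)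
    (by intros; simp; ring) (by intros; simp; ring) (by intros; simp; ring)
    (by intros; simp; ring)
  symm v w := by
    simp only [LinearMap.mk₂'ₛₗ_apply, map_add]
    rw [← h₁.symm, ← h₂.symm]
  nondeg v hv := by
    simp only [LinearMap.mk₂'ₛₗ_apply] at hv
    refine Prod.ext (h₁.nondeg _ fun w => ?_) (h₂.nondeg _ fun w => ?_)
    · simpa using hv (w, 0)
    · simpa using hv (0, w)

@[simp]
theorem prod_form (h₁ : HermForm c W₁) (h₂ : HermForm c W₂) (v w : W₁ × W₂) :
    (h₁.prod h₂).form v w = h₁.form v.1 w.1 + h₂.form v.2 w.2 := by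
  simp [prod]

section Adjoint

variable [Algebra.IsQuadraticExtension F E] [FiniteDimensional E W₁] [FiniteDimensional E W₂]
  [FiniteDimensional E W₃]

theorem exists_represents (h : HermForm c W₁) (l : W₁ →ₗ[E] E) :
    ∃ w, ∀ v, h.form v w = l v := by
  let _ : Module F W₁ := Module.compHom W₁ (algebraMap F E)
  have : IsScalarTower F E W₁ := IsScalarTower.of_algebraMap_smul fun _ _ => rfl
  have : FiniteDimensional F W₁ := Module.Finite.trans E W₁
  have : FiniteDimensional F (W₁ →ₗ[E] E) := Module.Finite.trans E (W₁ →ₗ[E] E)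
  let T : W₁ →ₗ[F] (W₁ →ₗ[E] E) :=
    { toFun := fun w => h.form.flip w
      map_add' := fun _ _ => map_add _ _ _
      map_smul' := fun a w => by
        apply LinearMap.ext
        intro v
        have e : a • w = algebraMap F E a • w := (algebraMap_smul E a w).symm
        change h.form v (a • w) = a • h.form v w
        rw [e, map_smulₛₗ]
        simp [Algebra.smul_def] }
  have hT : Function.Injective T := fun w w' H => h.ext_right fun v => LinearMap.congr_fun H v
  have hd : Module.finrank F W₁ = Module.finrank F (W₁ →ₗ[E] E) := by
    rw [← Module.finrank_mul_finrank F E W₁, ← Module.finrank_mul_finrank F E (W₁ →ₗ[E] E)]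
    congr 1
    exact (Subspace.dual_finrank_eq (K := E) (V := W₁)).symm
  obtain ⟨w, hw⟩ := (LinearMap.injective_iff_surjective_of_finrank_eq_finrank hd).1 hT l
  exact ⟨w, fun v => LinearMap.congr_fun hw v⟩

theorem exists_adjoint (h₁ : HermForm c W₁) (h₂ : HermForm c W₂) (X : W₂ →ₗ[E] W₁) :
    ∃ Y : W₁ →ₗ[E] W₂, ∀ v w, h₁.form (X v) w = h₂.form v (Y w) := by
  have : ∀ w, ∃ w', ∀ v, h₂.form v w' = h₁.form (X v) w := fun w =>
    h₂.exists_represents ((h₁.form.flip w).comp X)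
  choose Y hY using this
  refine ⟨{ toFun := Y, map_add' := fun w w' => ?_, map_smul' := fun a w => ?_ }, fun v w => ?_⟩
  · apply h₂.ext_right
    intro v
    simp [hY]
  · apply h₂.ext_right
    intro v
    simp [hY]
  · exact (hY w v).symm

variable [Module F W₁] [IsScalarTower F E W₁] [Module F W₂] [IsScalarTower F E W₂]
  [Module F W₃] [IsScalarTower F E W₃]

/-- The adjoint `X ↦ X*` for Hermitian spaces `W₂` and `W₁`: the unique map such that
`⟨X v, w⟩₁ = ⟨v, X* w⟩₂` (see `form_adj`). -/
noncomputable def adj (h₁ : HermForm c W₁) (h₂ : HermForm c W₂) :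
    (W₂ →ₗ[E] W₁) →ₗ[F] (W₁ →ₗ[E] W₂) where
  toFun X := (h₁.exists_adjoint h₂ X).choose
  map_add' X X' := by
    ext w
    apply h₂.ext_right
    intro v
    rw [← (h₁.exists_adjoint h₂ (X + X')).choose_spec]
    simp only [LinearMap.add_apply, map_add]
    rw [(h₁.exists_adjoint h₂ X).choose_spec, (h₁.exists_adjoint h₂ X').choose_spec]
  map_smul' a X := by
    ext w
    apply h₂.ext_right
    intro v
    rw [← (h₁.exists_adjoint h₂ (a • X)).choose_spec]
    have e : (a • X) v = algebraMap F E a • X v := (algebraMap_smul E a (X v)).symm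
    have e' : (a • (h₁.exists_adjoint h₂ X).choose) w =
        algebraMap F E a • (h₁.exists_adjoint h₂ X).choose w := (algebraMap_smul E a _).symm
    simp only [RingHom.id_apply]
    rw [e, e', map_smul, LinearMap.smul_apply, map_smulₛₗ,
      (h₁.exists_adjoint h₂ X).choose_spec]
    simp

theorem form_adj (h₁ : HermForm c W₁) (h₂ : HermForm c W₂) (X : W₂ →ₗ[E] W₁) (v : W₂) (w : W₁) :
    h₁.form (X v) w = h₂.form v (h₁.adj h₂ X w) :=
  (h₁.exists_adjoint h₂ X).choose_spec v w

theorem adj_unique (h₁ : HermForm c W₁) (h₂ : HermForm c W₂) {X : W₂ →ₗ[E] W₁}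
    {Y : W₁ →ₗ[E] W₂} (H : ∀ v w, h₁.form (X v) w = h₂.form v (Y w)) : h₁.adj h₂ X = Y := by
  ext w
  apply h₂.ext_right
  intro v
  rw [← form_adj, H]

theorem adj_adj (h₁ : HermForm c W₁) (h₂ : HermForm c W₂) (X : W₂ →ₗ[E] W₁) :
    h₂.adj h₁ (h₁.adj h₂ X) = X := by
  apply adj_unique
  intro v w
  rw [h₂.symm w, ← form_adj, ← h₁.symm]

theorem adj_comp (h₁ : HermForm c W₁) (h₂ : HermForm c W₂) (h₃ : HermForm c W₃)
    (X : W₂ →ₗ[E] W₁) (Y : W₃ →ₗ[E] W₂) :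
    h₁.adj h₃ (X ∘ₗ Y) = h₂.adj h₃ Y ∘ₗ h₁.adj h₂ X := by
  apply adj_unique
  intro v w
  simp [form_adj h₁ h₂, form_adj h₂ h₃]

end Adjoint

end HermForm

open HermForm

variable {c : E ≃ₐ[F] E}
variable {W : Type u} [AddCommGroup W] [Module E W] [Module F W] [IsScalarTower F E W]
variable {W₁ : Type u} [AddCommGroup W₁] [Module E W₁] [Module F W₁] [IsScalarTower F E W₁]
variable {W₂ : Type u} [AddCommGroup W₂] [Module E W₂] [Module F W₂] [IsScalarTower F E W₂]

/-- The twisted Lie algebra of Hermitian operators on `W`. -/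
def herm (h : HermForm c W) : Submodule F (Module.End E W) where
  carrier := {x | ∀ u v, h.form (x u) v = h.form u (x v)}
  add_mem' hx hy u v := by simp [hx u v, hy u v]
  zero_mem' u v := by simp
  smul_mem' a x hx u v := by
    rw [LinearMap.smul_apply, LinearMap.smul_apply, form_smul_left, form_smul_right, hx u v]

/-- The Lie algebra of the unitary group: the skew-Hermitian operators on `W`. -/
def unitaryLie (h : HermForm c W) : Submodule F (Module.End E W) where
  carrier := {x | ∀ u v, h.form (x u) v + h.form u (x v) = 0}
  add_mem' {x y} hx hy u v := by
    have := congrArg₂ (· + ·) (hx u v) (hy u v)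
    simp only [add_zero] at this
    simp only [LinearMap.add_apply, map_add]
    rw [← this]
    ring
  zero_mem' u v := by simp
  smul_mem' a x hx u v := by
    rw [LinearMap.smul_apply, LinearMap.smul_apply, form_smul_left, form_smul_right, ← mul_add,
      hx u v, mul_zero]

variable (E W₁ W₂) in
/-- The involution `σ(w₁ + w₂) = w₁ - w₂` of `W₁ ⊕ W₂`. -/
def sigma : Module.End E (W₁ × W₂) :=
  LinearMap.prodMap LinearMap.id (-LinearMap.id)

variable (F E W₁ W₂) in
/-- The involution `x ↦ σ x σ` of `End(W₁ ⊕ W₂)`. -/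
def conjSigma : Module.End E (W₁ × W₂) →ₗ[F] Module.End E (W₁ × W₂) :=
  (LinearMap.mulLeft F (sigma E W₁ W₂)).comp (LinearMap.mulRight F (sigma E W₁ W₂))

/-- The `(-1)`-eigenspace of `x ↦ σ x σ` on the Lie algebra of the unitary group
of `W₁ ⊕ W₂`. -/
def unitaryLieOne (h₁ : HermForm c W₁) (h₂ : HermForm c W₂) :
    Submodule F (Module.End E (W₁ × W₂)) where
  carrier := {x | x ∈ unitaryLie (h₁.prod h₂) ∧ conjSigma F E W₁ W₂ x = -x}
  add_mem' hx hy := ⟨add_mem hx.1 hy.1, by rw [map_add, hx.2, hy.2, neg_add]⟩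
  zero_mem' := ⟨zero_mem _, by simp⟩
  smul_mem' a _ hx := ⟨Submodule.smul_mem _ a hx.1, by rw [map_smul, hx.2, smul_neg]⟩

variable (F E W₁ W₂) in
/-- The block `Hom(W₂, W₁)` of an operator on `W₁ ⊕ W₂`. -/
def block₁₂ : Module.End E (W₁ × W₂) →ₗ[F] (W₂ →ₗ[E] W₁) where
  toFun x := LinearMap.fst E W₁ W₂ ∘ₗ x ∘ₗ LinearMap.inr E W₁ W₂
  map_add' x y := by ext; simp
  map_smul' a x := by ext; simp

variable (F E W₁ W₂) in
/-- Extension of operators on `W₁` by zero to `W₁ ⊕ W₂`. -/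
def extendFst : Module.End E W₁ →ₗ[F] Module.End E (W₁ × W₂) where
  toFun x := LinearMap.inl E W₁ W₂ ∘ₗ x ∘ₗ LinearMap.fst E W₁ W₂
  map_add' x y := by ext <;> simp
  map_smul' a x := by ext <;> simp

variable (F E W₁ W₂) in
/-- Extension of operators on `W₂` by zero to `W₁ ⊕ W₂`. -/
def extendSnd : Module.End E W₂ →ₗ[F] Module.End E (W₁ × W₂) where
  toFun x := LinearMap.inr E W₁ W₂ ∘ₗ x ∘ₗ LinearMap.snd E W₁ W₂
  map_add' x y := by ext <;> simp
  map_smul' a x := by ext <;> simp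

section Finite

variable [Algebra.IsQuadraticExtension F E] [FiniteDimensional E W]
  [FiniteDimensional E W₁] [FiniteDimensional E W₂]

instance finite_submodule_end (U : Submodule F (Module.End E W)) : FiniteDimensional F U :=
  haveI : FiniteDimensional F (Module.End E W) := Module.Finite.trans E (Module.End E W)
  inferInstance

theorem mem_herm_iff (h : HermForm c W) (x : Module.End E W) :
    x ∈ herm h ↔ h.adj h x = x :=
  ⟨fun hx => h.adj_unique h hx, fun hx u v => by rw [h.form_adj h, hx]⟩

theorem mem_unitaryLie_iff (h : HermForm c W) (x : Module.End E W) :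
    x ∈ unitaryLie h ↔ h.adj h x = -x := by
  constructor
  · intro hx
    apply h.adj_unique h
    intro v w
    have := hx v w
    simp only [LinearMap.neg_apply, map_neg]
    exact eq_neg_of_add_eq_zero_left this
  · intro hx u v
    rw [h.form_adj h, hx]
    simp

theorem adj_extendFst (h₁ : HermForm c W₁) (h₂ : HermForm c W₂) (g : Module.End E W₁) :
    (h₁.prod h₂).adj (h₁.prod h₂) (extendFst F E W₁ W₂ g) =
      extendFst F E W₁ W₂ (h₁.adj h₁ g) := by
  apply adj_unique
  intro v w
  simp [extendFst, h₁.form_adj h₁]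

theorem adj_extendSnd (h₁ : HermForm c W₁) (h₂ : HermForm c W₂) (g : Module.End E W₂) :
    (h₁.prod h₂).adj (h₁.prod h₂) (extendSnd F E W₁ W₂ g) =
      extendSnd F E W₁ W₂ (h₂.adj h₂ g) := by
  apply adj_unique
  intro v w
  simp [extendSnd, h₂.form_adj h₂]

/-- The operator `(0, X; -X*, 0)` on `W₁ ⊕ W₂`, for `X : W₂ → W₁`. -/
noncomputable def deltaFun (h₁ : HermForm c W₁) (h₂ : HermForm c W₂) (X : W₂ →ₗ[E] W₁) :
    Module.End E (W₁ × W₂) :=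
  LinearMap.prod (X ∘ₗ LinearMap.snd E W₁ W₂) (-(h₁.adj h₂ X ∘ₗ LinearMap.fst E W₁ W₂))

@[simp]
theorem deltaFun_apply (h₁ : HermForm c W₁) (h₂ : HermForm c W₂) (X : W₂ →ₗ[E] W₁)
    (w : W₁ × W₂) : deltaFun h₁ h₂ X w = (X w.2, -(h₁.adj h₂ X w.1)) := rfl

theorem deltaFun_mem (h₁ : HermForm c W₁) (h₂ : HermForm c W₂) (X : W₂ →ₗ[E] W₁) :
    deltaFun h₁ h₂ X ∈ unitaryLieOne h₁ h₂ := by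
  constructor
  · intro v w
    have e : h₁.form v.1 (X w.2) = h₂.form (h₁.adj h₂ X v.1) w.2 := by
      rw [h₂.form_adj h₁, adj_adj]
    simp only [prod_form, deltaFun_apply, map_neg, LinearMap.neg_apply, e, h₁.form_adj h₂]
    ring
  · apply LinearMap.ext
    intro w
    simp [conjSigma, sigma]

theorem eq_deltaFun (h₁ : HermForm c W₁) (h₂ : HermForm c W₂) (h2 : (2 : F) ≠ 0)
    {x : Module.End E (W₁ × W₂)} (hx : x ∈ unitaryLieOne h₁ h₂) :
    x = deltaFun h₁ h₂ (block₁₂ F E W₁ W₂ x) := by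
  have key : ∀ {M : Type u} [AddCommGroup M] [Module F M] (m : M), m = -m → m = 0 := by
    intro M _ _ m hm
    have : (2 : F) • m = 0 := by
      rw [two_smul]
      nth_rewrite 2 [hm]
      exact add_neg_cancel m
    exact (smul_eq_zero.1 this).resolve_left h2
  have hσ : ∀ w : W₁ × W₂, ((x (w.1, -w.2)).1, -(x (w.1, -w.2)).2) = -x w := by
    intro w
    have := LinearMap.congr_fun hx.2 w
    rw [LinearMap.neg_apply] at this
    rw [← this]
    rfl
  have h11 : ∀ w, (x (w, 0)).1 = 0 := fun w => key _ (by
    simpa using congrArg Prod.fst (hσ (w, 0)))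
  have h22 : ∀ w, (x (0, w)).2 = 0 := fun w => key _ (by
    have e : ((0 : W₁), -w) = -((0 : W₁), w) := by simp
    have := congrArg Prod.snd (hσ (0, w))
    simp only [e, map_neg, Prod.snd_neg, neg_neg] at this
    exact this)
  have hadj : ∀ w, h₁.adj h₂ (block₁₂ F E W₁ W₂ x) w = -(x (w, 0)).2 := by
    have : h₁.adj h₂ (block₁₂ F E W₁ W₂ x) =
        -(LinearMap.snd E W₁ W₂ ∘ₗ x ∘ₗ LinearMap.inl E W₁ W₂) := by
      apply adj_unique
      intro v w
      have := hx.1 (0, v) (w, 0)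
      simp only [prod_form, map_zero, LinearMap.zero_apply, add_zero, zero_add] at this
      simpa [block₁₂] using eq_neg_of_add_eq_zero_left this
    intro w
    rw [this]
    rfl
  apply LinearMap.ext
  rintro ⟨v, w⟩
  have e : (v, w) = (v, (0 : W₂)) + ((0 : W₁), w) := by simp
  rw [deltaFun_apply, hadj, e, map_add]
  apply Prod.ext
  · simp [h11, block₁₂]
  · simp [h22]

/-- The identification of `Hom(W₂, W₁)` with the `(-1)`-eigenspace, in block form
`X ↦ (0, X; -X*, 0)`. -/
noncomputable def delta (h₁ : HermForm c W₁) (h₂ : HermForm c W₂) (h2 : (2 : F) ≠ 0) :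
    (W₂ →ₗ[E] W₁) ≃ₗ[F] unitaryLieOne h₁ h₂ :=
  LinearEquiv.symm
    { toLinearMap := (block₁₂ F E W₁ W₂).comp (unitaryLieOne h₁ h₂).subtype
      invFun := fun X => ⟨deltaFun h₁ h₂ X, deltaFun_mem h₁ h₂ X⟩
      left_inv := fun x => Subtype.ext (eq_deltaFun h₁ h₂ h2 x.2).symm
      right_inv := fun _ => LinearMap.ext fun _ => rfl }

theorem coe_delta (h₁ : HermForm c W₁) (h₂ : HermForm c W₂) (h2 : (2 : F) ≠ 0)
    (X : W₂ →ₗ[E] W₁) : (delta h₁ h₂ h2 X : Module.End E (W₁ × W₂)) = deltaFun h₁ h₂ X := rfl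

/-! ### Points over a commutative `F`-algebra `R`

All the spaces of operators above are `F`-vector spaces; their extension of scalars to `R` is
`R ⊗[F] _`, and linear maps between them, such as the adjoint, are extended `R`-linearly. -/

section BaseChange

variable (R : Type u) [CommRing R] [Algebra F R]

section Flat

variable {M N : Type u} [AddCommGroup M] [Module F M] [AddCommGroup N] [Module F N]

theorem baseChange_subtype_injective (U : Submodule F M) :
    Function.Injective (U.subtype.baseChange R) :=
  Module.Flat.lTensor_preserves_injective_linearMap (M := R) U.subtype U.injective_subtype

theorem mem_range_baseChange_subtype (U : Submodule F M) (L : M →ₗ[F] N)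
    (hU : ∀ x, x ∈ U ↔ L x = 0) (x : R ⊗[F] M) (hx : L.baseChange R x = 0) :
    ∃ y, U.subtype.baseChange R y = x := by
  have hex : Function.Exact U.subtype L := fun x => by
    rw [← hU]
    simp
  exact (Module.Flat.lTensor_exact R hex x).1 hx

theorem baseChange_baseChange_subtype (U : Submodule F M) (L : M →ₗ[F] N)
    (hU : ∀ x ∈ U, L x = 0) (y : R ⊗[F] U) : L.baseChange R (U.subtype.baseChange R y) = 0 := by
  induction y with
  | zero => simp
  | add x y hx hy => rw [map_add, map_add, hx, hy, add_zero]
  | tmul r u => simp [hU u u.2]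

end Flat

section Comp

variable {W₃ : Type u} [AddCommGroup W₃] [Module E W₃] [Module F W₃] [IsScalarTower F E W₃]

variable (F E W₁ W₂ W₃) in
/-- Composition of operators, as a bilinear map. -/
def compBilin : (W₂ →ₗ[E] W₁) →ₗ[F] (W₃ →ₗ[E] W₂) →ₗ[F] (W₃ →ₗ[E] W₁) :=
  LinearMap.mk₂ F (fun X Y => X ∘ₗ Y) (by intros; ext; simp) (by intros; ext; simp)
    (by intros; ext; simp) (by intros; ext; simp)

/-- Composition of operators over `R`: `(r ⊗ X)(s ⊗ Y) = rs ⊗ XY`. -/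
noncomputable def compR (X : R ⊗[F] (W₂ →ₗ[E] W₁)) (Y : R ⊗[F] (W₃ →ₗ[E] W₂)) :
    R ⊗[F] (W₃ →ₗ[E] W₁) :=
  TensorProduct.map₂ (LinearMap.mul F R) (compBilin F E W₁ W₂ W₃) X Y

theorem compR_tmul (r s : R) (X : W₂ →ₗ[E] W₁) (Y : W₃ →ₗ[E] W₂) :
    compR R (r ⊗ₜ[F] X) (s ⊗ₜ[F] Y) = (r * s) ⊗ₜ[F] (X ∘ₗ Y) := by
  simp [compR, compBilin]

theorem compR_add (X : R ⊗[F] (W₂ →ₗ[E] W₁)) (Y Y' : R ⊗[F] (W₃ →ₗ[E] W₂)) :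
    compR R X (Y + Y') = compR R X Y + compR R X Y' := by
  simp [compR]

theorem add_compR (X X' : R ⊗[F] (W₂ →ₗ[E] W₁)) (Y : R ⊗[F] (W₃ →ₗ[E] W₂)) :
    compR R (X + X') Y = compR R X Y + compR R X' Y := by
  simp [compR]

@[simp]
theorem compR_zero (X : R ⊗[F] (W₂ →ₗ[E] W₁)) :
    compR R X (0 : R ⊗[F] (W₃ →ₗ[E] W₂)) = 0 := by
  simp [compR]

@[simp]
theorem zero_compR (Y : R ⊗[F] (W₃ →ₗ[E] W₂)) :
    compR R (0 : R ⊗[F] (W₂ →ₗ[E] W₁)) Y = 0 := by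
  simp [compR]

end Comp

/-- The adjoint over `R`. -/
noncomputable def adjR (h₁ : HermForm c W₁) (h₂ : HermForm c W₂) :
    R ⊗[F] (W₂ →ₗ[E] W₁) →ₗ[R] R ⊗[F] (W₁ →ₗ[E] W₂) :=
  (h₁.adj h₂).baseChange R

theorem adjR_adjR (h₁ : HermForm c W₁) (h₂ : HermForm c W₂) (X : R ⊗[F] (W₂ →ₗ[E] W₁)) :
    adjR R h₂ h₁ (adjR R h₁ h₂ X) = X := by
  induction X with
  | zero => simp
  | add x y hx hy => rw [map_add, map_add, hx, hy]
  | tmul r X => simp [adjR, adj_adj]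

theorem adjR_compR {W₃ : Type u} [AddCommGroup W₃] [Module E W₃] [Module F W₃]
    [IsScalarTower F E W₃] [FiniteDimensional E W₃]
    (h₁ : HermForm c W₁) (h₂ : HermForm c W₂) (h₃ : HermForm c W₃)
    (X : R ⊗[F] (W₂ →ₗ[E] W₁)) (Y : R ⊗[F] (W₃ →ₗ[E] W₂)) :
    adjR R h₁ h₃ (compR R X Y) = compR R (adjR R h₂ h₃ Y) (adjR R h₁ h₂ X) := by
  induction X with
  | zero => simp
  | add x y hx hy => rw [add_compR, map_add, map_add, hx, hy, compR_add]
  | tmul r X =>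
    induction Y with
    | zero => simp
    | add x y hx hy => rw [compR_add, map_add, map_add, hx, hy, add_compR]
    | tmul s Y => simp [adjR, compR_tmul, adj_comp h₁ h₂ h₃, mul_comm]

theorem adjR_mul (h : HermForm c W) (x y : R ⊗[F] Module.End E W) :
    adjR R h h (x * y) = adjR R h h y * adjR R h h x := by
  induction x with
  | zero => simp
  | add x y hx hy => rw [add_mul, map_add, map_add, hx, hy, mul_add]
  | tmul r X =>
    induction y with
    | zero => simp
    | add x y hx hy => rw [mul_add, map_add, map_add, hx, hy, add_mul]
    | tmul s Y => simp [adjR, Module.End.mul_eq_comp, adj_comp h h h, mul_comm]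

theorem neg_mulR (x y : R ⊗[F] Module.End E W) : -x * y = -(x * y) := neg_mul x y

theorem mul_negR (x y : R ⊗[F] Module.End E W) : x * -y = -(x * y) := mul_neg x y

theorem adj_one (h : HermForm c W) : h.adj h (1 : Module.End E W) = 1 :=
  h.adj_unique h fun _ _ => rfl

theorem adjR_one (h : HermForm c W) : adjR R h h (1 : R ⊗[F] Module.End E W) = 1 := by
  simp [adjR, Algebra.TensorProduct.one_def, adj_one]

/-- The group of `R`-points of the unitary group: the invertible elements `g` of `R ⊗ End(W)`
whose inverse is `g*`. -/
def unitaryGroup (h : HermForm c W) : Subgroup (R ⊗[F] Module.End E W)ˣ where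
  carrier := {g | (g : R ⊗[F] Module.End E W) * adjR R h h g = 1}
  one_mem' := by simp [adjR_one]
  mul_mem' {a b} ha hb := by
    simp only [Set.mem_ofPred_eq] at ha hb ⊢
    rw [Units.val_mul, adjR_mul, mul_assoc, ← mul_assoc (b : R ⊗[F] Module.End E W), hb, one_mul,
      ha]
  inv_mem' {a} ha := by
    simp only [Set.mem_ofPred_eq] at ha ⊢
    have e : adjR R h h a = ((a⁻¹ : (R ⊗[F] Module.End E W)ˣ) : R ⊗[F] Module.End E W) :=
      (Units.inv_eq_of_mul_eq_one_right ha).symm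
    rw [← e, adjR_adjR, e, Units.inv_mul]

theorem adjR_unitaryGroup (h : HermForm c W) (g : unitaryGroup R h) :
    adjR R h h ((g : (R ⊗[F] Module.End E W)ˣ) : R ⊗[F] Module.End E W) =
      ((g⁻¹ : unitaryGroup R h) : (R ⊗[F] Module.End E W)ˣ) :=
  (Units.inv_eq_of_mul_eq_one_right g.2).symm

/-! #### Hermitian operators -/

/-- The inclusion of `R ⊗ Herm(W)` into `R ⊗ End(W)` identifies it with the self-adjoint
elements. -/
noncomputable def hermEquiv (h : HermForm c W) :
    R ⊗[F] herm h ≃ {z : R ⊗[F] Module.End E W // adjR R h h z = z} :=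
  Equiv.ofBijective
    (fun z => ⟨(herm h).subtype.baseChange R z, by
      have := baseChange_baseChange_subtype R (herm h) (h.adj h - LinearMap.id)
        (fun x hx => by simp [(mem_herm_iff h x).1 hx]) z
      simpa [adjR, LinearMap.baseChange_sub, sub_eq_zero] using this⟩)
    ⟨fun _ _ H => baseChange_subtype_injective R _ (congrArg Subtype.val H), fun z => by
      obtain ⟨y, hy⟩ := mem_range_baseChange_subtype R (herm h) (h.adj h - LinearMap.id)
        (fun x => by simp [mem_herm_iff, sub_eq_zero]) z.1 (by
          have := z.2
          simpa [adjR, LinearMap.baseChange_sub, sub_eq_zero] using this)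
      exact ⟨y, Subtype.ext hy⟩⟩

/-- The adjoint action of the unitary group on the Hermitian operators: `z ↦ g z g⁻¹`. -/
noncomputable def hermAct (h : HermForm c W) (g : unitaryGroup R h) (z : R ⊗[F] herm h) :
    R ⊗[F] herm h :=
  (hermEquiv R h).symm
    ⟨((g : (R ⊗[F] Module.End E W)ˣ) : R ⊗[F] Module.End E W) * (hermEquiv R h z).1 *
        ((g⁻¹ : unitaryGroup R h) : (R ⊗[F] Module.End E W)ˣ), by
      rw [adjR_mul, adjR_mul, adjR_unitaryGroup, adjR_unitaryGroup, (hermEquiv R h z).2, inv_inv,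
        mul_assoc]⟩

/-! #### The `(-1)`-eigenspace -/

/-- The inclusion of `R ⊗ 𝔲(W)₁` into `R ⊗ End(W)` identifies it with the skew-adjoint elements
on which the involution `x ↦ σ x σ` is `-1`. -/
noncomputable def lieEquiv (h₁ : HermForm c W₁) (h₂ : HermForm c W₂) :
    R ⊗[F] unitaryLieOne h₁ h₂ ≃ {x : R ⊗[F] Module.End E (W₁ × W₂) //
      adjR R (h₁.prod h₂) (h₁.prod h₂) x = -x ∧ (conjSigma F E W₁ W₂).baseChange R x = -x} :=
  Equiv.ofBijective
    (fun z => ⟨(unitaryLieOne h₁ h₂).subtype.baseChange R z, by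
      have e1 := baseChange_baseChange_subtype R (unitaryLieOne h₁ h₂)
        ((h₁.prod h₂).adj (h₁.prod h₂) + LinearMap.id)
        (fun x hx => by simp [(mem_unitaryLie_iff _ x).1 hx.1]) z
      have e2 := baseChange_baseChange_subtype R (unitaryLieOne h₁ h₂)
        (conjSigma F E W₁ W₂ + LinearMap.id) (fun x hx => by simp [hx.2]) z
      rw [LinearMap.baseChange_add, LinearMap.baseChange_id, LinearMap.add_apply] at e1 e2
      exact ⟨eq_neg_of_add_eq_zero_left e1, eq_neg_of_add_eq_zero_left e2⟩⟩)
    ⟨fun _ _ H => baseChange_subtype_injective R _ (congrArg Subtype.val H), fun z => by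
      let L := ((h₁.prod h₂).adj (h₁.prod h₂) + LinearMap.id).prod
        (conjSigma F E W₁ W₂ + LinearMap.id)
      obtain ⟨y, hy⟩ := mem_range_baseChange_subtype R (unitaryLieOne h₁ h₂) L
        (fun x => by
          have e : L x = ((h₁.prod h₂).adj (h₁.prod h₂) x + x, conjSigma F E W₁ W₂ x + x) := rfl
          rw [e, Prod.mk_eq_zero, add_eq_zero_iff_eq_neg, add_eq_zero_iff_eq_neg,
            ← mem_unitaryLie_iff]
          rfl) z.1 (by
          apply (TensorProduct.prodRight F R R _ _).injective
          have hL : ∀ x, TensorProduct.prodRight F R R _ _ (L.baseChange R x) =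
              (adjR R (h₁.prod h₂) (h₁.prod h₂) x + x,
                (conjSigma F E W₁ W₂).baseChange R x + x) := by
            intro x
            induction x with
            | zero => simp only [map_zero, add_zero, Prod.mk_zero_zero]
            | add x y hx hy =>
              rw [map_add, map_add, hx, hy, map_add, map_add]
              ext <;> simp only [Prod.fst_add, Prod.snd_add] <;> abel
            | tmul r x => simp [L, adjR, TensorProduct.tmul_add]
          rw [hL, map_zero, z.2.1, z.2.2]
          simp)
      exact ⟨y, Subtype.ext hy⟩⟩

/-- The block diagonal operator `(g, 0; 0, h)` over `R`. -/
noncomputable def diagR (g : R ⊗[F] Module.End E W₁) (h : R ⊗[F] Module.End E W₂) :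
    R ⊗[F] Module.End E (W₁ × W₂) :=
  (extendFst F E W₁ W₂).baseChange R g + (extendSnd F E W₁ W₂).baseChange R h

theorem adjR_diagR (h₁ : HermForm c W₁) (h₂ : HermForm c W₂) (g : R ⊗[F] Module.End E W₁)
    (h : R ⊗[F] Module.End E W₂) :
    adjR R (h₁.prod h₂) (h₁.prod h₂) (diagR R g h) =
      diagR R (adjR R h₁ h₁ g) (adjR R h₂ h₂ h) := by
  have e1 : adjR R (h₁.prod h₂) (h₁.prod h₂) ((extendFst F E W₁ W₂).baseChange R g) =
      (extendFst F E W₁ W₂).baseChange R (adjR R h₁ h₁ g) := by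
    induction g with
    | zero => simp
    | add x y hx hy => simp only [map_add, hx, hy]
    | tmul r x => simp [adjR, adj_extendFst]
  have e2 : adjR R (h₁.prod h₂) (h₁.prod h₂) ((extendSnd F E W₁ W₂).baseChange R h) =
      (extendSnd F E W₁ W₂).baseChange R (adjR R h₂ h₂ h) := by
    induction h with
    | zero => simp
    | add x y hx hy => simp only [map_add, hx, hy]
    | tmul r x => simp [adjR, adj_extendSnd]
  rw [diagR, map_add, e1, e2, diagR]

theorem sigma_mul_sigma : sigma E W₁ W₂ * sigma E W₁ W₂ = 1 := by
  apply LinearMap.ext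
  intro w
  simp [sigma]

theorem conjSigma_mul (x y : R ⊗[F] Module.End E (W₁ × W₂)) :
    (conjSigma F E W₁ W₂).baseChange R (x * y) =
      (conjSigma F E W₁ W₂).baseChange R x * (conjSigma F E W₁ W₂).baseChange R y := by
  induction x with
  | zero => simp
  | add x y hx hy => rw [add_mul, map_add, map_add, hx, hy, add_mul]
  | tmul r X =>
    induction y with
    | zero => simp
    | add x y hx hy => rw [mul_add, map_add, map_add, hx, hy, mul_add]
    | tmul s Y =>
      have : conjSigma F E W₁ W₂ (X * Y) = conjSigma F E W₁ W₂ X * conjSigma F E W₁ W₂ Y := by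
        simp only [conjSigma, LinearMap.comp_apply, LinearMap.mulLeft_apply,
          LinearMap.mulRight_apply]
        calc sigma E W₁ W₂ * (X * Y * sigma E W₁ W₂)
            = sigma E W₁ W₂ * X * 1 * Y * sigma E W₁ W₂ := by simp only [mul_one, mul_assoc]
          _ = _ := by rw [← sigma_mul_sigma]; simp only [mul_assoc]
      simp [this]

theorem conjSigma_diagR (g : R ⊗[F] Module.End E W₁) (h : R ⊗[F] Module.End E W₂) :
    (conjSigma F E W₁ W₂).baseChange R (diagR R g h) = diagR R g h := by
  have e1 : (conjSigma F E W₁ W₂).baseChange R ((extendFst F E W₁ W₂).baseChange R g) =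
      (extendFst F E W₁ W₂).baseChange R g := by
    induction g with
    | zero => simp
    | add x y hx hy => simp only [map_add, hx, hy]
    | tmul r x =>
      have : conjSigma F E W₁ W₂ (extendFst F E W₁ W₂ x) = extendFst F E W₁ W₂ x := by
        apply LinearMap.ext
        intro w
        simp [conjSigma, sigma, extendFst]
      simp [this]
  have e2 : (conjSigma F E W₁ W₂).baseChange R ((extendSnd F E W₁ W₂).baseChange R h) =
      (extendSnd F E W₁ W₂).baseChange R h := by
    induction h with
    | zero => simp
    | add x y hx hy => simp only [map_add, hx, hy]
    | tmul r x =>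
      have : conjSigma F E W₁ W₂ (extendSnd F E W₁ W₂ x) = extendSnd F E W₁ W₂ x := by
        apply LinearMap.ext
        intro w
        simp [conjSigma, sigma, extendSnd]
      simp [this]
  rw [diagR, map_add, e1, e2]

/-- The restriction of the adjoint action of `U(W₁ ⊕ W₂)` to an action of `U(W₁) × U(W₂)` on
`𝔲(W)₁`: `x ↦ diag(g, h) x diag(g, h)⁻¹`. -/
noncomputable def lieAct (h₁ : HermForm c W₁) (h₂ : HermForm c W₂)
    (g : unitaryGroup R h₁ × unitaryGroup R h₂) (x : R ⊗[F] unitaryLieOne h₁ h₂) :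
    R ⊗[F] unitaryLieOne h₁ h₂ :=
  (lieEquiv R h₁ h₂).symm
    ⟨diagR R ((g.1 : (R ⊗[F] Module.End E W₁)ˣ) : R ⊗[F] Module.End E W₁)
          ((g.2 : (R ⊗[F] Module.End E W₂)ˣ) : R ⊗[F] Module.End E W₂) *
        (lieEquiv R h₁ h₂ x).1 *
        diagR R ((g.1⁻¹ : unitaryGroup R h₁) : (R ⊗[F] Module.End E W₁)ˣ)
          ((g.2⁻¹ : unitaryGroup R h₂) : (R ⊗[F] Module.End E W₂)ˣ), by
      constructor
      · rw [adjR_mul, adjR_mul, adjR_diagR, adjR_diagR, adjR_unitaryGroup, adjR_unitaryGroup,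
          adjR_unitaryGroup, adjR_unitaryGroup, (lieEquiv R h₁ h₂ x).2.1, inv_inv, inv_inv, mul_assoc]
        rw [neg_mulR, mul_negR]
      · rw [conjSigma_mul, conjSigma_mul, conjSigma_diagR, conjSigma_diagR,
          (lieEquiv R h₁ h₂ x).2.2]
        rw [mul_negR, neg_mulR]⟩

/-! #### The contraction -/

/-- The contraction over `R`: `x ↦ -X X*`, where `X` is the `Hom(W₂, W₁)`-block of `x`. -/
noncomputable def contractionR (h₁ : HermForm c W₁) (h₂ : HermForm c W₂)
    (x : R ⊗[F] unitaryLieOne h₁ h₂) : R ⊗[F] herm h₁ :=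
  let X : R ⊗[F] (W₂ →ₗ[E] W₁) := (block₁₂ F E W₁ W₂).baseChange R (lieEquiv R h₁ h₂ x).1
  (hermEquiv R h₁).symm ⟨-compR R X (adjR R h₁ h₂ X), by
    rw [map_neg, adjR_compR R h₁ h₂ h₁, adjR_adjR]⟩

theorem coe_contractionR (h₁ : HermForm c W₁) (h₂ : HermForm c W₂)
    (x : R ⊗[F] unitaryLieOne h₁ h₂) (X : R ⊗[F] (W₂ →ₗ[E] W₁))
    (hX : (block₁₂ F E W₁ W₂).baseChange R (lieEquiv R h₁ h₂ x).1 = X) :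
    (hermEquiv R h₁ (contractionR R h₁ h₂ x)).1 = -compR R X (adjR R h₁ h₂ X) := by
  subst hX
  exact congrArg Subtype.val (Equiv.apply_symm_apply (hermEquiv R h₁) _)

end BaseChange

/-- On `F`-points, and more generally on elements `1 ⊗ δ(X)`, the contraction is `-X X*`. -/
theorem contractionR_delta (R : Type u) [CommRing R] [Algebra F R]
    (h₁ : HermForm c W₁) (h₂ : HermForm c W₂) (h2 : (2 : F) ≠ 0) (X : W₂ →ₗ[E] W₁) :
    (hermEquiv R h₁ (contractionR R h₁ h₂ (1 ⊗ₜ[F] delta h₁ h₂ h2 X))).1 =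
      1 ⊗ₜ[F] (-(X ∘ₗ h₁.adj h₂ X) : Module.End E W₁) := by
  have hX : block₁₂ F E W₁ W₂ (deltaFun h₁ h₂ X) = X := LinearMap.ext fun _ => rfl
  have e : (lieEquiv R h₁ h₂ (1 ⊗ₜ[F] delta h₁ h₂ h2 X)).1 = 1 ⊗ₜ[F] deltaFun h₁ h₂ X :=
    LinearMap.baseChange_tmul _ _ _
  rw [coe_contractionR R h₁ h₂ _ (1 ⊗ₜ[F] X) (by rw [e, LinearMap.baseChange_tmul, hX]), adjR,
    LinearMap.baseChange_tmul, compR_tmul, mul_one, TensorProduct.tmul_neg]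

theorem contractionR_natural {R S : Type u} [CommRing R] [Algebra F R] [CommRing S] [Algebra F S]
    (h₁ : HermForm c W₁) (h₂ : HermForm c W₂) (φ : S →ₐ[F] R)
    (x : S ⊗[F] unitaryLieOne h₁ h₂) :
    mapScalars φ (herm h₁) (contractionR S h₁ h₂ x) =
      contractionR R h₁ h₂ (mapScalars φ (unitaryLieOne h₁ h₂) x) := by
  have hcomp : ∀ (X : S ⊗[F] (W₂ →ₗ[E] W₁)) (Y : S ⊗[F] (W₁ →ₗ[E] W₂)),
      mapScalars φ _ (compR S X Y) = compR R (mapScalars φ _ X) (mapScalars φ _ Y) := by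
    intro X Y
    induction X with
    | zero => simp
    | add x y hx hy => simp only [map_add, add_compR, hx, hy]
    | tmul r X =>
      induction Y with
      | zero => simp
      | add x y hx hy => simp only [map_add, compR_add, hx, hy]
      | tmul s Y => simp [mapScalars, compR_tmul]
  have hH : ∀ (T : Type u) [CommRing T] [Algebra F T] (z : T ⊗[F] herm h₁),
      (hermEquiv T h₁ z).1 = (herm h₁).subtype.baseChange T z := fun _ _ _ _ => rfl
  have hL : ∀ (T : Type u) [CommRing T] [Algebra F T] (z : T ⊗[F] unitaryLieOne h₁ h₂),
      (lieEquiv T h₁ h₂ z).1 = (unitaryLieOne h₁ h₂).subtype.baseChange T z := fun _ _ _ _ => rfl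
  have hX : mapScalars φ _ ((block₁₂ F E W₁ W₂).baseChange S (lieEquiv S h₁ h₂ x).1) =
      (block₁₂ F E W₁ W₂).baseChange R
        (lieEquiv R h₁ h₂ (mapScalars φ (unitaryLieOne h₁ h₂) x)).1 := by
    rw [hL, hL, mapScalars_baseChange, mapScalars_baseChange]
  have hA : ∀ X, mapScalars φ _ (adjR S h₁ h₂ X) = adjR R h₁ h₂ (mapScalars φ _ X) :=
    fun X => mapScalars_baseChange φ _ X
  apply (hermEquiv R h₁).injective
  apply Subtype.ext
  rw [hH, ← mapScalars_baseChange, ← hH, coe_contractionR S h₁ h₂ _ _ rfl, coe_contractionR R h₁ h₂ _ _ rfl,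
    map_neg, hcomp, hA, hX]

/-! ### The schemes, the actions and the contraction morphism -/

/-- The action of `U(W₁) × U(W₂)` on the points of the scheme `𝔲(W)₁`. -/
noncomputable def schemeLieAct (h₁ : HermForm c W₁) (h₂ : HermForm c W₂)
    (R : Type u) [CommRing R] [Algebra F R] (g : unitaryGroup R h₁ × unitaryGroup R h₂)
    (x : specOver F R ⟶ affineSpace F (unitaryLieOne h₁ h₂)) :
    specOver F R ⟶ affineSpace F (unitaryLieOne h₁ h₂) :=
  points R (lieAct R h₁ h₂ g ((points R).symm x))

/-- The adjoint action of `U(W)` on the points of the scheme `Herm(W)`. -/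
noncomputable def schemeHermAct (h : HermForm c W)
    (R : Type u) [CommRing R] [Algebra F R] (g : unitaryGroup R h)
    (z : specOver F R ⟶ affineSpace F (herm h)) : specOver F R ⟶ affineSpace F (herm h) :=
  points R (hermAct R h g ((points R).symm z))

/-- The contraction as a morphism of schemes `r : 𝔲(W)₁ ⟶ Herm(W₁)` over `F`. -/
noncomputable def contraction (h₁ : HermForm c W₁) (h₂ : HermForm c W₂) :
    affineSpace F (unitaryLieOne h₁ h₂) ⟶ affineSpace F (herm h₁) :=
  ofPointMaps fun R _ _ => contractionR R h₁ h₂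

theorem points_contraction (h₁ : HermForm c W₁) (h₂ : HermForm c W₂)
    (R : Type u) [CommRing R] [Algebra F R] (x : R ⊗[F] unitaryLieOne h₁ h₂) :
    points R x ≫ contraction h₁ h₂ = points R (contractionR R h₁ h₂ x) := by
  unfold contraction
  apply points_ofPointMaps R
  intro R S _ _ _ _ φ x
  exact contractionR_natural h₁ h₂ φ x

end Finite
end Hermitian
end UnitarySymmetricPair

open UnitarySymmetricPair

/-! Fix an `E`-linear isomorphism `φ : W₂ ≃ W₁`, which exists because the dimensions agree, and
write `X = P φ` with `P` in `End(W₁)`. With `H = φ φ*` one has `X X* = P H P*`. Conjugation by `φ`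
turns `U(W₂)` into the group of all `k` with `k H k* = H`, acting by `P ↦ P k⁻¹`, while `U(W₁)` acts
by left multiplication. Both equivariance statements follow directly from this.

For the universal property, pass to an `F`-algebra `R` that receives `E`. There `R ⊗ End(W₁)` splits
into two factors which the adjoint interchanges. The unitary group becomes a general linear group, a
point becomes a pair of matrices `(A, B)`, the action becomes `(A, B) ↦ (A g⁻¹, g B)` up to
normalisation by `H`, and the contraction becomes `-A B`. It then has an explicit section `s`,
namely `z ↦ (-z, H⁻¹)` (`contractionR_contractionSection`), and every `x` with invertible coordinate
`P` lies in the `U(W₂)`-orbit of `s(r(x))` (`exists_lieAct_eq_contractionSection`).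

Let `f` be an invariant morphism to a separated scheme. Then `f ∘ s ∘ r = f` at the generic point of
the scalar extension to `E`, where `P` is invertible. Since this scalar extension is integral and
the target is separated, equality holds everywhere (`points_comp_eq_of_isInvariant`). The section
depends on the map `E → R`, but `f ∘ s` does not: two sections `s`, `s'` coming from two such maps
satisfy `f(s(z)) = f(s(r(s'(z)))) = f(s'(z))`. Hence `f ∘ s` descends from `E` to `F` by faithfully
flat descent and gives the factorisation (`isCategoricalQuotient_contraction`). Uniqueness holds
because `r` has a section after the same scalar extension. -/

namespace UnitarySymmetricPair

/-! ### Extension of scalars and a determinant criterion for units. -/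

section MapScalars

variable {F : Type u} [Field F]
variable {R S T : Type u} [CommRing R] [Algebra F R] [CommRing S] [Algebra F S]
  [CommRing T] [Algebra F T]

@[simp]
theorem mapScalars_tmul (φ : S →ₐ[F] R) {M : Type u} [AddCommMonoid M] [Module F M] (s : S)
    (m : M) : mapScalars φ M (s ⊗ₜ[F] m) = φ s ⊗ₜ[F] m := by
  simp [mapScalars]

theorem mapScalars_comp (ψ : R →ₐ[F] T) (φ : S →ₐ[F] R) {M : Type u} [AddCommMonoid M]
    [Module F M] (x : S ⊗[F] M) :
    mapScalars (ψ.comp φ) M x = mapScalars ψ M (mapScalars φ M x) := by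
  induction x with
  | zero => simp
  | add x y hx hy => simp only [map_add, hx, hy]
  | tmul s m => simp

theorem mapScalars_mul (φ : S →ₐ[F] R) {D : Type u} [Ring D] [Algebra F D] (x y : S ⊗[F] D) :
    mapScalars φ D (x * y) = mapScalars φ D x * mapScalars φ D y :=
  map_mul (Algebra.TensorProduct.map φ (AlgHom.id F D)) x y

section RegularRepresentation

variable (D : Type u) [Ring D] [Algebra F D] [FiniteDimensional F D]

variable (F R) in
/-- The regular representation of the `F`-algebra `D`, over `R`, in the coordinates of a
basis. -/
noncomputable def regularRepr :
    R ⊗[F] D →ₐ[R] Matrix (Fin (Module.finrank F D)) (Fin (Module.finrank F D)) R :=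
  Algebra.TensorProduct.lift (Algebra.ofId R _)
    ((Algebra.ofId F R).mapMatrix.comp (Algebra.leftMulMatrix (Module.finBasis F D)))
    (fun r _ => show Commute (Algebra.ofId R _ r) _ from Algebra.commutes r _)

theorem regularRepr_tmul (r : R) (d : D) (i k) :
    regularRepr F R D (r ⊗ₜ[F] d) i k =
      r * algebraMap F R (Algebra.leftMulMatrix (Module.finBasis F D) d i k) := by
  rw [regularRepr, Algebra.TensorProduct.lift_tmul, Algebra.ofId_apply, ← Algebra.smul_def,
    Matrix.smul_apply, smul_eq_mul]
  rfl

/-- Consequently the determinant of the regular representation commutes with specialisation, which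
is how invertibility is compared between different base rings. -/
theorem regularRepr_mapScalars (φ : S →ₐ[F] R) (z : S ⊗[F] D) :
    regularRepr F R D (mapScalars φ D z) = φ.mapMatrix (regularRepr F S D z) := by
  induction z with
  | zero => simp
  | add x y hx hy => simp only [map_add, hx, hy]
  | tmul s d => ext i k; simp [regularRepr_tmul]

variable {D} in
theorem regularRepr_eq_sum (z : R ⊗[F] D) (i k) :
    regularRepr F R D z i k =
      ((Algebra.TensorProduct.basis R (Module.finBasis F D)).repr
        (z * (1 ⊗ₜ[F] Module.finBasis F D k))) i := by
  induction z with
  | zero => simp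
  | add x y hx hy => simp only [map_add, Matrix.add_apply, hx, hy, add_mul, Finsupp.add_apply]
  | tmul s d =>
    rw [regularRepr_tmul, Algebra.leftMulMatrix_eq_repr_mul, Algebra.TensorProduct.tmul_mul_tmul,
      mul_one, Algebra.TensorProduct.basis_repr_tmul]
    simp

/-- Left multiplication by an element of the kernel kills every basis vector, hence kills `1`. -/
theorem regularRepr_injective : Function.Injective (regularRepr F R D) := by
  rw [injective_iff_map_eq_zero]
  intro z hz
  have h : ∀ k, z * (1 ⊗ₜ[F] Module.finBasis F D k) = 0 := fun k => by
    apply (Algebra.TensorProduct.basis R (Module.finBasis F D)).repr.injective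
    ext i
    rw [← regularRepr_eq_sum, hz]
    simp
  have h1 : ∀ d : D, z * (1 ⊗ₜ[F] d) = 0 := fun d => by
    rw [← (Module.finBasis F D).sum_repr d, TensorProduct.tmul_sum, Finset.mul_sum]
    simp only [TensorProduct.tmul_smul, mul_smul_comm, h, smul_zero, Finset.sum_const_zero]
  have := h1 1
  rwa [← Algebra.TensorProduct.one_def, mul_one] at this

/-- An element which specialises to a unit is a unit over every field that contains the base
ring. -/
theorem isUnit_mapScalars_of_specialization {K : Type u} [Field K] [Algebra F K]
    [Nontrivial T] (φ : S →ₐ[F] T) (ψ : S →ₐ[F] K) (hψ : Function.Injective ψ) (z : S ⊗[F] D)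
    (hz : IsUnit (mapScalars φ D z)) : IsUnit (mapScalars ψ D z) := by
  -- The determinant specialises to that of a unit, and in the nontrivial ring `T` this is not zero.
  have h1 : (regularRepr F S D z).det ≠ 0 := by
    intro h0
    have h2 := (hz.map (regularRepr F T D)).map Matrix.detMonoidHom
    rw [regularRepr_mapScalars, Matrix.coe_detMonoidHom, ← AlgHom.map_det, h0, map_zero] at h2
    exact not_isUnit_zero h2
  have h3 : IsUnit (regularRepr F K D (mapScalars ψ D z)) := by
    rw [Matrix.isUnit_iff_isUnit_det, regularRepr_mapScalars, ← AlgHom.map_det]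
    exact ((map_ne_zero_iff ψ hψ).2 h1).isUnit
  -- The matrix is invertible, but its inverse need not visibly lie in the image of the
  -- representation. It is enough that `z` is not a zero divisor, since the algebra is
  -- finite-dimensional over the field `K`.
  have : IsArtinianRing (K ⊗[F] D) := IsArtinianRing.of_finite K _
  apply IsArtinianRing.isUnit_of_mem_nonZeroDivisors
  constructor
  · intro x hx
    apply regularRepr_injective (R := K) D
    rw [map_zero]
    apply h3.mul_left_cancel
    rw [← map_mul, hx, map_zero, mul_zero]
  · intro x hx
    apply regularRepr_injective (R := K) D
    rw [map_zero]
    apply h3.mul_right_cancel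
    rw [← map_mul, hx, map_zero, zero_mul]

end RegularRepresentation

end MapScalars

/-! ### The coordinate `P = X φ⁻¹`: contraction and actions in terms of `End(W₁)`. -/

section Coordinates

variable {F E : Type u} [Field F] [Field E] [Algebra F E]
variable {c : E ≃ₐ[F] E}
variable {W₁ : Type u} [AddCommGroup W₁] [Module E W₁] [Module F W₁] [IsScalarTower F E W₁]
variable {W₂ : Type u} [AddCommGroup W₂] [Module E W₂] [Module F W₂] [IsScalarTower F E W₂]
variable [Algebra.IsQuadraticExtension F E] [FiniteDimensional E W₁] [FiniteDimensional E W₂]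

variable (F) in
/-- The identification of `Hom(W₂, W₁)` with `End(W₁)` given by an isomorphism `W₂ ≃ W₁`. -/
def homEquivEnd (φ : W₂ ≃ₗ[E] W₁) : (W₂ →ₗ[E] W₁) ≃ₗ[F] Module.End E W₁ where
  toFun X := X ∘ₗ φ.symm.toLinearMap
  invFun P := P ∘ₗ φ.toLinearMap
  map_add' _ _ := rfl
  map_smul' _ _ := rfl
  left_inv X := by ext; simp
  right_inv P := by ext; simp

/-- The Hermitian operator `φ φ*` on `W₁` attached to an isomorphism `φ : W₂ ≃ W₁`. -/
noncomputable def gram (h₁ : HermForm c W₁) (h₂ : HermForm c W₂) (φ : W₂ ≃ₗ[E] W₁) :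
    Module.End E W₁ :=
  φ.toLinearMap ∘ₗ h₁.adj h₂ φ.toLinearMap

/-- The inverse `(φ⁻¹)* φ⁻¹` of `φ φ*`. -/
noncomputable def gramInv (h₁ : HermForm c W₁) (h₂ : HermForm c W₂) (φ : W₂ ≃ₗ[E] W₁) :
    Module.End E W₁ :=
  h₂.adj h₁ φ.symm.toLinearMap ∘ₗ φ.symm.toLinearMap

theorem adj_id (h : HermForm c W₁) : h.adj h (LinearMap.id : W₁ →ₗ[E] W₁) = LinearMap.id :=
  h.adj_unique h fun _ _ => rfl

theorem gram_mul_gramInv (h₁ : HermForm c W₁) (h₂ : HermForm c W₂) (φ : W₂ ≃ₗ[E] W₁) :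
    gram h₁ h₂ φ * gramInv h₁ h₂ φ = 1 := by
  have h : h₁.adj h₂ φ.toLinearMap ∘ₗ h₂.adj h₁ φ.symm.toLinearMap = LinearMap.id := by
    rw [← HermForm.adj_comp h₂ h₁ h₂, LinearEquiv.symm_comp, adj_id]
  apply LinearMap.ext
  intro w
  have := LinearMap.congr_fun h (φ.symm w)
  simp only [LinearMap.comp_apply, LinearMap.id_apply] at this
  simp [gram, gramInv, this]

theorem gramInv_mul_gram (h₁ : HermForm c W₁) (h₂ : HermForm c W₂) (φ : W₂ ≃ₗ[E] W₁) :
    gramInv h₁ h₂ φ * gram h₁ h₂ φ = 1 := by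
  have h : h₂.adj h₁ φ.symm.toLinearMap ∘ₗ h₁.adj h₂ φ.toLinearMap = LinearMap.id := by
    rw [← HermForm.adj_comp h₁ h₂ h₁, LinearEquiv.comp_symm, adj_id]
  apply LinearMap.ext
  intro w
  have := LinearMap.congr_fun h w
  simp only [LinearMap.comp_apply, LinearMap.id_apply] at this
  simp [gram, gramInv, this]

theorem adj_gram (h₁ : HermForm c W₁) (h₂ : HermForm c W₂) (φ : W₂ ≃ₗ[E] W₁) :
    h₁.adj h₁ (gram h₁ h₂ φ) = gram h₁ h₂ φ := by
  rw [gram, HermForm.adj_comp h₁ h₂ h₁, HermForm.adj_adj]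

theorem adj_gramInv (h₁ : HermForm c W₁) (h₂ : HermForm c W₂) (φ : W₂ ≃ₗ[E] W₁) :
    h₁.adj h₁ (gramInv h₁ h₂ φ) = gramInv h₁ h₂ φ := by
  rw [gramInv, HermForm.adj_comp h₁ h₂ h₁, HermForm.adj_adj]

variable (R : Type u) [CommRing R] [Algebra F R]

/-- In the coordinates given by `φ : W₂ ≃ W₁`, the product `X X*` is `P (φ φ*) P*`. -/
theorem compR_adjR (h₁ : HermForm c W₁) (h₂ : HermForm c W₂) (φ : W₂ ≃ₗ[E] W₁)
    (X : R ⊗[F] (W₂ →ₗ[E] W₁)) :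
    compR R X (adjR R h₁ h₂ X) =
      (homEquivEnd F φ).toLinearMap.baseChange R X * (1 ⊗ₜ[F] gram h₁ h₂ φ) *
        adjR R h₁ h₁ ((homEquivEnd F φ).toLinearMap.baseChange R X) := by
  -- The expression is quadratic in `X`; polarising it to two independent variables makes induction
  -- on tensors possible.
  have key : ∀ (X Y : R ⊗[F] (W₂ →ₗ[E] W₁)), compR R X (adjR R h₁ h₂ Y) =
      (homEquivEnd F φ).toLinearMap.baseChange R X * (1 ⊗ₜ[F] gram h₁ h₂ φ) *
        adjR R h₁ h₁ ((homEquivEnd F φ).toLinearMap.baseChange R Y) := by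
    intro X Y
    induction X with
    | zero => simp
    | add x y hx hy => rw [add_compR, map_add, add_mul, add_mul, hx, hy]
    | tmul r X =>
      induction Y with
      | zero => simp
      | add x y hx hy => rw [map_add, compR_add, map_add, map_add, mul_add, hx, hy]
      | tmul s Y =>
        simp only [adjR, LinearMap.baseChange_tmul, compR_tmul,
          Algebra.TensorProduct.tmul_mul_tmul, mul_one]
        congr 1
        have e : Y = (Y ∘ₗ φ.symm.toLinearMap) ∘ₗ φ.toLinearMap := by ext; simp
        conv_lhs => rw [e, HermForm.adj_comp h₁ h₁ h₂]
        apply LinearMap.ext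
        intro w
        simp [homEquivEnd, gram]
  exact key X X

/-- Conjugation by `φ : W₂ ≃ W₁`, over `R`. -/
noncomputable def conjR (φ : W₂ ≃ₗ[E] W₁) :
    R ⊗[F] Module.End E W₂ ≃ₐ[R] R ⊗[F] Module.End E W₁ :=
  Algebra.TensorProduct.congr AlgEquiv.refl (φ.conjAlgEquiv F)

theorem conjR_tmul (φ : W₂ ≃ₗ[E] W₁) (r : R) (g : Module.End E W₂) :
    conjR R φ (r ⊗ₜ[F] g) = r ⊗ₜ[F] (φ.toLinearMap ∘ₗ g ∘ₗ φ.symm.toLinearMap) := rfl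

/-- Since `φ` need not be an isometry, the adjoint of `W₂` is transported to the adjoint of `W₁`
twisted by the Gram operator `H = φ φ*`. -/
theorem conjR_adjR (h₁ : HermForm c W₁) (h₂ : HermForm c W₂) (φ : W₂ ≃ₗ[E] W₁)
    (g : R ⊗[F] Module.End E W₂) :
    conjR R φ (adjR R h₂ h₂ g) =
      (1 ⊗ₜ[F] gram h₁ h₂ φ) * adjR R h₁ h₁ (conjR R φ g) * (1 ⊗ₜ[F] gramInv h₁ h₂ φ) := by
  induction g with
  | zero => simp
  | add x y hx hy => simp only [map_add, hx, hy, mul_add, add_mul]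
  | tmul r g =>
    simp only [conjR_tmul, adjR, LinearMap.baseChange_tmul, Algebra.TensorProduct.tmul_mul_tmul,
      one_mul, mul_one]
    congr 1
    rw [HermForm.adj_comp h₁ h₂ h₁, HermForm.adj_comp h₂ h₂ h₁]
    have h : h₁.adj h₂ φ.toLinearMap ∘ₗ h₂.adj h₁ φ.symm.toLinearMap = LinearMap.id := by
      rw [← HermForm.adj_comp h₂ h₁ h₂, LinearEquiv.symm_comp, adj_id]
    have h' : ∀ w, h₁.adj h₂ φ.toLinearMap (h₂.adj h₁ φ.symm.toLinearMap w) = w :=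
      LinearMap.congr_fun h
    apply LinearMap.ext
    intro w
    simp [gram, gramInv, h']

variable (F) in
/-- The coordinate `P = X φ⁻¹` of an operator on `W₁ ⊕ W₂` with `Hom(W₂, W₁)`-block `X`. -/
def blockCoord (φ : W₂ ≃ₗ[E] W₁) : Module.End E (W₁ × W₂) →ₗ[F] Module.End E W₁ :=
  (homEquivEnd F φ).toLinearMap.comp (block₁₂ F E W₁ W₂)

theorem blockCoord_diagR_mul (φ : W₂ ≃ₗ[E] W₁) (g : R ⊗[F] Module.End E W₁)
    (h : R ⊗[F] Module.End E W₂) (y : R ⊗[F] Module.End E (W₁ × W₂)) :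
    (blockCoord F φ).baseChange R (diagR R g h * y) = g * (blockCoord F φ).baseChange R y := by
  have e1 : (blockCoord F φ).baseChange R ((extendFst F E W₁ W₂).baseChange R g * y) =
      g * (blockCoord F φ).baseChange R y := by
    induction g with
    | zero => simp
    | add x y hx hy => simp only [map_add, add_mul, hx, hy]
    | tmul r g =>
      induction y with
      | zero => simp
      | add x y hx hy => simp only [map_add, mul_add, hx, hy]
      | tmul s y =>
        simp only [LinearMap.baseChange_tmul, Algebra.TensorProduct.tmul_mul_tmul]
        rfl
  have e2 : (blockCoord F φ).baseChange R ((extendSnd F E W₁ W₂).baseChange R h * y) = 0 := by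
    clear e1
    induction h with
    | zero => simp
    | add x y hx hy => simp only [map_add, add_mul, hx, hy, add_zero]
    | tmul r g =>
      induction y with
      | zero => simp
      | add x y hx hy => simp only [map_add, mul_add, hx, hy, add_zero]
      | tmul s y =>
        have : blockCoord F φ (extendSnd F E W₁ W₂ g * y) = 0 := by
          apply LinearMap.ext
          intro w
          simp [blockCoord, homEquivEnd, block₁₂, extendSnd]
        simp [this]
  rw [diagR, add_mul, map_add, e1, e2, add_zero]

theorem blockCoord_mul_diagR (φ : W₂ ≃ₗ[E] W₁) (g : R ⊗[F] Module.End E W₁)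
    (h : R ⊗[F] Module.End E W₂) (y : R ⊗[F] Module.End E (W₁ × W₂)) :
    (blockCoord F φ).baseChange R (y * diagR R g h) =
      (blockCoord F φ).baseChange R y * conjR R φ h := by
  have e1 : (blockCoord F φ).baseChange R (y * (extendFst F E W₁ W₂).baseChange R g) = 0 := by
    induction g with
    | zero => simp
    | add x y hx hy => simp only [map_add, mul_add, hx, hy, add_zero]
    | tmul r g =>
      induction y with
      | zero => simp
      | add x y hx hy => simp only [map_add, add_mul, hx, hy, add_zero]
      | tmul s y =>
        have : blockCoord F φ (y * extendFst F E W₁ W₂ g) = 0 := by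
          apply LinearMap.ext
          intro w
          have e : ((0 : W₁), (0 : W₂)) = 0 := rfl
          simp [blockCoord, homEquivEnd, block₁₂, extendFst, e]
        simp [this]
  have e2 : (blockCoord F φ).baseChange R (y * (extendSnd F E W₁ W₂).baseChange R h) =
      (blockCoord F φ).baseChange R y * conjR R φ h := by
    clear e1
    induction h with
    | zero => simp
    | add x y hx hy => simp only [map_add, mul_add, hx, hy]
    | tmul r g =>
      induction y with
      | zero => simp
      | add x y hx hy => simp only [map_add, add_mul, hx, hy]
      | tmul s y =>
        simp only [LinearMap.baseChange_tmul, Algebra.TensorProduct.tmul_mul_tmul, conjR_tmul]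
        congr 1
        apply LinearMap.ext
        intro w
        simp [blockCoord, homEquivEnd, block₁₂, extendSnd]
  rw [diagR, mul_add, map_add, e1, e2, zero_add]

variable (F) in
/-- The coordinate `P = X φ⁻¹` of `δ(X)`. -/
noncomputable def lieCoord (h₁ : HermForm c W₁) (h₂ : HermForm c W₂) (h2 : (2 : F) ≠ 0)
    (φ : W₂ ≃ₗ[E] W₁) : unitaryLieOne h₁ h₂ ≃ₗ[F] Module.End E W₁ :=
  (delta h₁ h₂ h2).symm.trans (homEquivEnd F φ)

/-- The coordinate `P = X φ⁻¹` of `δ(X)`, over `R`. -/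
noncomputable def lieCoordR (h₁ : HermForm c W₁) (h₂ : HermForm c W₂) (h2 : (2 : F) ≠ 0)
    (φ : W₂ ≃ₗ[E] W₁) : R ⊗[F] unitaryLieOne h₁ h₂ ≃ₗ[R] R ⊗[F] Module.End E W₁ :=
  (lieCoord F h₁ h₂ h2 φ).baseChange F R _ _

variable (h₁ : HermForm c W₁) (h₂ : HermForm c W₂) (h2 : (2 : F) ≠ 0) (φ : W₂ ≃ₗ[E] W₁)

theorem lieCoordR_eq_baseChange (x : R ⊗[F] unitaryLieOne h₁ h₂) :
    lieCoordR R h₁ h₂ h2 φ x = (lieCoord F h₁ h₂ h2 φ).toLinearMap.baseChange R x := rfl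

theorem lieCoordR_eq_blockCoord (x : R ⊗[F] unitaryLieOne h₁ h₂) :
    lieCoordR R h₁ h₂ h2 φ x = (blockCoord F φ).baseChange R (lieEquiv R h₁ h₂ x).1 := by
  change _ = (blockCoord F φ).baseChange R ((unitaryLieOne h₁ h₂).subtype.baseChange R x)
  rw [← LinearMap.comp_apply, ← LinearMap.baseChange_comp]
  rfl

theorem hermEquiv_contractionR (x : R ⊗[F] unitaryLieOne h₁ h₂) :
    (hermEquiv R h₁ (contractionR R h₁ h₂ x)).1 =
      -(lieCoordR R h₁ h₂ h2 φ x * (1 ⊗ₜ[F] gram h₁ h₂ φ) *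
        adjR R h₁ h₁ (lieCoordR R h₁ h₂ h2 φ x)) := by
  rw [coe_contractionR R h₁ h₂ x _ rfl, compR_adjR R h₁ h₂ φ, lieCoordR_eq_blockCoord, blockCoord,
    LinearMap.baseChange_comp, LinearMap.comp_apply]

/-- The off-diagonal block of `diag(g, h) x diag(g, h)⁻¹` is `g X h⁻¹`, so the two groups act on the
coordinate from opposite sides. -/
theorem lieCoordR_lieAct (g : unitaryGroup R h₁ × unitaryGroup R h₂)
    (x : R ⊗[F] unitaryLieOne h₁ h₂) :
    lieCoordR R h₁ h₂ h2 φ (lieAct R h₁ h₂ g x) =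
      ((g.1 : (R ⊗[F] Module.End E W₁)ˣ) : R ⊗[F] Module.End E W₁) *
        lieCoordR R h₁ h₂ h2 φ x *
        conjR R φ ((g.2⁻¹ : unitaryGroup R h₂) : (R ⊗[F] Module.End E W₂)ˣ) := by
  rw [lieCoordR_eq_blockCoord, lieCoordR_eq_blockCoord, lieAct, Equiv.apply_symm_apply,
    blockCoord_mul_diagR, blockCoord_diagR_mul]

theorem tmul_gram_mul_gramInv :
    ((1 : R) ⊗ₜ[F] gram h₁ h₂ φ) * (1 ⊗ₜ[F] gramInv h₁ h₂ φ) = 1 := by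
  rw [Algebra.TensorProduct.tmul_mul_tmul, gram_mul_gramInv, one_mul]; rfl

theorem tmul_gramInv_mul_gram :
    ((1 : R) ⊗ₜ[F] gramInv h₁ h₂ φ) * (1 ⊗ₜ[F] gram h₁ h₂ φ) = 1 := by
  rw [Algebra.TensorProduct.tmul_mul_tmul, gramInv_mul_gram, one_mul]; rfl

theorem adjR_gram : adjR R h₁ h₁ ((1 : R) ⊗ₜ[F] gram h₁ h₂ φ) = 1 ⊗ₜ[F] gram h₁ h₂ φ := by
  simp [adjR, adj_gram]

theorem adjR_gramInv :
    adjR R h₁ h₁ ((1 : R) ⊗ₜ[F] gramInv h₁ h₂ φ) = 1 ⊗ₜ[F] gramInv h₁ h₂ φ := by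
  simp [adjR, adj_gramInv]

/-- The conjugate of `h ∈ U(W₂)` is unitary for the Hermitian operator `φ φ*`. -/
theorem conjR_unitaryGroup (h : unitaryGroup R h₂) :
    conjR R φ ((h : (R ⊗[F] Module.End E W₂)ˣ) : R ⊗[F] Module.End E W₂) *
        (1 ⊗ₜ[F] gram h₁ h₂ φ) *
      adjR R h₁ h₁ (conjR R φ ((h : (R ⊗[F] Module.End E W₂)ˣ) : R ⊗[F] Module.End E W₂)) =
        1 ⊗ₜ[F] gram h₁ h₂ φ := by
  have e := congrArg (conjR R φ) h.2
  rw [map_mul, conjR_adjR R h₁ h₂, map_one] at e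
  have e' := congrArg (· * ((1 : R) ⊗ₜ[F] gram h₁ h₂ φ)) e
  simp only [mul_assoc, one_mul] at e'
  rw [tmul_gramInv_mul_gram, mul_one] at e'
  rw [mul_assoc, e']

theorem contractionR_lieAct_snd (h : unitaryGroup R h₂) (h2 : (2 : F) ≠ 0) (φ : W₂ ≃ₗ[E] W₁)
    (x : R ⊗[F] unitaryLieOne h₁ h₂) :
    contractionR R h₁ h₂ (lieAct R h₁ h₂ (1, h) x) = contractionR R h₁ h₂ x := by
  apply (hermEquiv R h₁).injective
  apply Subtype.ext
  rw [hermEquiv_contractionR R h₁ h₂ h2 φ, hermEquiv_contractionR R h₁ h₂ h2 φ, lieCoordR_lieAct]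
  -- The coordinate is multiplied on the right by the conjugate `k` of `h⁻¹`, so `P H P*` becomes `P
  -- (k H k*) P*`, and the bracket equals `H`.
  have e := conjR_unitaryGroup R h₁ h₂ φ h⁻¹
  simp only [OneMemClass.coe_one, Units.val_one, one_mul, adjR_mul]
  conv_rhs => rw [← e]
  simp only [mul_assoc]

theorem contractionR_lieAct_fst (g : unitaryGroup R h₁) (h2 : (2 : F) ≠ 0) (φ : W₂ ≃ₗ[E] W₁)
    (x : R ⊗[F] unitaryLieOne h₁ h₂) :
    contractionR R h₁ h₂ (lieAct R h₁ h₂ (g, 1) x) = hermAct R h₁ g (contractionR R h₁ h₂ x) := by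
  apply (hermEquiv R h₁).injective
  apply Subtype.ext
  rw [hermAct, Equiv.apply_symm_apply, hermEquiv_contractionR R h₁ h₂ h2 φ, lieCoordR_lieAct]
  simp only [hermEquiv_contractionR R h₁ h₂ h2 φ]
  simp only [inv_one, OneMemClass.coe_one, Units.val_one, map_one, mul_one, adjR_mul,
    adjR_unitaryGroup]
  rw [mul_negR, neg_mulR]
  simp only [mul_assoc]

end Coordinates

/-! ### Rings split by a central idempotent. -/

section Blend

variable {A : Type*} [Ring A]

/-- The element of a ring with components `a` and `b` with respect to an idempotent `e` and its
complement. -/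
def blend (e a b : A) : A := e * a + (1 - e) * b

/-- A central idempotent decomposes the ring as a product, in which multiplication is componentwise.
-/
theorem blend_mul_blend {e : A} (he : e * e = e) (hc : ∀ x, e * x = x * e) (a b a' b' : A) :
    blend e a b * blend e a' b' = blend e (a * a') (b * b') := by
  have hf : ∀ x, (1 - e) * x = x * (1 - e) := fun x => by rw [sub_mul, mul_sub, hc x]; simp
  have hff : (1 - e) * (1 - e) = 1 - e := by simp [mul_sub, sub_mul, he]
  have hef : e * (1 - e) = 0 := by simp [mul_sub, he]
  have hfe : (1 - e) * e = 0 := by simp [sub_mul, he]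
  have key : ∀ p q x y : A, (∀ z, q * z = z * q) → p * x * (q * y) = p * q * (x * y) := by
    intro p q x y hq
    rw [mul_assoc, ← mul_assoc x, ← hq x]
    simp only [mul_assoc]
  simp only [blend, add_mul, mul_add, key _ _ _ _ hc, key _ _ _ _ hf, he, hff, hef, hfe, zero_mul,
    add_zero, zero_add]

theorem blend_self (e a : A) : blend e a a = a := by
  rw [blend, ← add_mul, add_sub_cancel, one_mul]

theorem mul_blend {e : A} (he : e * e = e) (hc : ∀ x, e * x = x * e) (x a b : A) :
    x * blend e a b = blend e (x * a) (x * b) := by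
  rw [← blend_mul_blend he hc, blend_self]

theorem blend_mul {e : A} (he : e * e = e) (hc : ∀ x, e * x = x * e) (x a b : A) :
    blend e a b * x = blend e (a * x) (b * x) := by
  rw [← blend_mul_blend he hc, blend_self]

/-- An anti-homomorphism exchanging `e` and `1 - e` exchanges the two factors, so the components
trade places. -/
theorem map_blend_of_antihom {e : A} (hc : ∀ x, e * x = x * e) (s : A → A)
    (hadd : ∀ x y, s (x + y) = s x + s y) (hmul : ∀ x y, s (x * y) = s y * s x)
    (he : s e = 1 - e) (he' : s (1 - e) = e) (a b : A) :
    s (blend e a b) = blend e (s b) (s a) := by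
  have hf : ∀ x, (1 - e) * x = x * (1 - e) := fun x => by rw [sub_mul, mul_sub, hc x]; simp
  rw [blend, hadd, hmul, hmul, he, he', ← hc, ← hf, add_comm, blend]

end Blend

/-! ### A purely imaginary generator of the quadratic extension. -/

section Imaginary

variable {F E : Type u} [Field F] [Field E] [Algebra F E] [Algebra.IsQuadraticExtension F E]

/-- Completing the square, which requires characteristic different from 2. -/
theorem exists_imaginary (h2 : (2 : F) ≠ 0) {c : E ≃ₐ[F] E} (hc : c ≠ AlgEquiv.refl) :
    ∃ (i : E) (d : F), i * i = algebraMap F E d ∧ c i = -i ∧ d ≠ 0 := by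
  obtain ⟨a, ha⟩ : ∃ a, c a ≠ a := by
    by_contra! h
    exact hc (AlgEquiv.ext h)
  have hfin : Module.finrank F E = 2 := Algebra.IsQuadraticExtension.finrank_eq_two F E
  have hli : LinearIndependent F ![(1 : E), a] := by
    rw [LinearIndependent.pair_iff]
    intro s t hst
    have ht : t = 0 := by
      by_contra ht
      have e : a = algebraMap F E (-(t⁻¹ * s)) := by
        have h' := congrArg (t⁻¹ • ·) hst
        simp only [smul_add, smul_smul, inv_mul_cancel₀ ht, one_smul, smul_zero] at h'
        rw [map_neg, Algebra.algebraMap_eq_smul_one]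
        exact eq_neg_of_add_eq_zero_right h'
      apply ha
      rw [e, AlgEquiv.commutes]
    subst ht
    simpa using hst
  have hspan : ∀ x : E, ∃ s t : F, s • (1 : E) + t • a = x := by
    intro x
    have h := hli.span_eq_top_of_card_eq_finrank (by simp [hfin])
    have hx : x ∈ Submodule.span F (Set.range ![(1 : E), a]) := h ▸ Submodule.mem_top
    rw [Matrix.range_cons_cons_empty] at hx
    exact Submodule.mem_span_pair.1 hx
  obtain ⟨q, p, hpq⟩ := hspan (a * a)
  have h2E : (2 : E) ≠ 0 := by
    rw [← map_ofNat (algebraMap F E) 2]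
    exact (map_ne_zero (algebraMap F E)).2 h2
  simp only [Algebra.smul_def, mul_one] at hpq
  -- From `a² = q + p a` one gets `(2a - p)² = 4q + p²`.
  let i : E := 2 * a - algebraMap F E p
  have hii : i * i = algebraMap F E (4 * q + p * p) := by
    simp only [i, map_add, map_mul, map_ofNat]
    linear_combination (-4) * hpq
  have hci : c i ≠ i := by
    intro h
    simp only [i, map_sub, map_mul, map_ofNat, AlgEquiv.commutes, sub_left_inj] at h
    exact ha (mul_left_cancel₀ h2E h)
  have hneg : c i = -i := by
    have h : (c i - i) * (c i + i) = 0 := by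
      have := congrArg c hii
      rw [map_mul, AlgEquiv.commutes, ← hii] at this
      linear_combination this
    exact eq_neg_of_add_eq_zero_left ((mul_eq_zero.1 h).resolve_left (sub_ne_zero.2 hci))
  -- If `d` were zero then `i` would be zero and hence fixed by `c`.
  refine ⟨i, 4 * q + p * p, hii, hneg, fun h0 => hci ?_⟩
  rw [h0, map_zero, mul_self_eq_zero] at hii
  rw [hii, map_zero]

end Imaginary

/-! ### The section of the contraction over algebras containing a square root of `d`. -/

section Section

variable {F E : Type u} [Field F] [Field E] [Algebra F E]
variable {c : E ≃ₐ[F] E}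
variable {W₁ : Type u} [AddCommGroup W₁] [Module E W₁] [Module F W₁] [IsScalarTower F E W₁]
variable {W₂ : Type u} [AddCommGroup W₂] [Module E W₂] [Module F W₂] [IsScalarTower F E W₂]

variable (F W₁) in
/-- The element `1/2 + j ⊗ i / (2 d)` of `R ⊗ End(W₁)`: a central idempotent if
`i² = d = j²`. -/
noncomputable def splitIdem (i : E) (d : F) {R : Type u} [CommRing R] [Algebra F R] (j : R) :
    R ⊗[F] Module.End E W₁ :=
  algebraMap F R 2⁻¹ ⊗ₜ[F] 1 + (algebraMap F R (2 * d)⁻¹ * j) ⊗ₜ[F] (i • 1)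

theorem mapScalars_splitIdem (i : E) (d : F) {R S : Type u} [CommRing R] [Algebra F R]
    [CommRing S] [Algebra F S] (f : S →ₐ[F] R) (j : S) :
    mapScalars f _ (splitIdem F W₁ i d j) = splitIdem F W₁ i d (f j) := by
  simp [splitIdem]

variable (R : Type u) [CommRing R] [Algebra F R]

theorem splitIdem_mul_comm (i : E) (d : F) (j : R) (x : R ⊗[F] Module.End E W₁) :
    splitIdem F W₁ i d j * x = x * splitIdem F W₁ i d j := by
  induction x with
  | zero => rw [mul_zero, zero_mul]
  | add x y hx hy => rw [mul_add, add_mul, hx, hy]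
  | tmul r x =>
    rw [splitIdem, add_mul, mul_add]
    simp only [Algebra.TensorProduct.tmul_mul_tmul, one_mul, mul_one, mul_comm r]
    congr 2
    ext w
    simp

/-- The second summand `u = j ⊗ i / (2d)` satisfies `u² = j² i² / (4d²) = 1/4`, so `(1/2 + u)² = 1/4
+ u + 1/4 = 1/2 + u`. -/
theorem splitIdem_mul_self (h2 : (2 : F) ≠ 0) {i : E} {d : F} (hd : d ≠ 0)
    (hi : i * i = algebraMap F E d) {j : R} (hj : j * j = algebraMap F R d) :
    splitIdem F W₁ i d j * splitIdem F W₁ i d j = splitIdem F W₁ i d j := by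
  have e : ((i • 1 : Module.End E W₁) * (i • 1)) = d • 1 := by
    ext w
    simp [smul_smul, hi]
  have e1 : algebraMap F R (2 * d)⁻¹ * j * (algebraMap F R (2 * d)⁻¹ * j) =
      algebraMap F R (2⁻¹ * 2⁻¹ * d⁻¹) := by
    calc _ = algebraMap F R (2 * d)⁻¹ * algebraMap F R (2 * d)⁻¹ * (j * j) := by ring
      _ = _ := by
        rw [hj, ← map_mul, ← map_mul]
        congr 1
        field_simp
  have e2 : algebraMap F R 2⁻¹ * algebraMap F R 2⁻¹ + algebraMap F R 2⁻¹ * algebraMap F R 2⁻¹ =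
      algebraMap F R 2⁻¹ := by
    rw [← map_mul, ← map_add]
    congr 1
    field_simp
    norm_num
  have e3 : algebraMap F R 2⁻¹ + algebraMap F R 2⁻¹ = 1 := by
    rw [← map_add, ← map_one (algebraMap F R)]
    congr 1
    field_simp
    norm_num
  have e4 : algebraMap F R (2⁻¹ * 2⁻¹ * d⁻¹) ⊗ₜ[F] (d • (1 : Module.End E W₁)) =
      (algebraMap F R 2⁻¹ * algebraMap F R 2⁻¹) ⊗ₜ[F] 1 := by
    rw [← TensorProduct.smul_tmul, Algebra.smul_def, ← map_mul, ← map_mul]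
    congr 2
    field_simp
  simp only [splitIdem, add_mul, mul_add, Algebra.TensorProduct.tmul_mul_tmul, one_mul, mul_one, e,
    e1]
  rw [e4, add_add_add_comm, add_comm (_ ⊗ₜ[F] (i • 1)),
    add_add_add_comm, ← TensorProduct.add_tmul, e2, ← TensorProduct.add_tmul,
    mul_comm _ (algebraMap F R 2⁻¹), ← add_mul, e3, one_mul]

variable [Algebra.IsQuadraticExtension F E] [FiniteDimensional E W₁] [FiniteDimensional E W₂]

/-- The adjoint of multiplication by `i` is multiplication by `c i = -i`, so taking adjoints flips
the sign of the second summand: the two factors of `R ⊗ End(W₁)` are interchanged. -/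
theorem adjR_splitIdem (h₁ : HermForm c W₁) (h2 : (2 : F) ≠ 0) {i : E} (hi : c i = -i) (d : F)
    (j : R) : adjR R h₁ h₁ (splitIdem F W₁ i d j) = 1 - splitIdem F W₁ i d j := by
  have e : h₁.adj h₁ (i • 1 : Module.End E W₁) = -(i • 1) := by
    apply HermForm.adj_unique
    intro v w
    simp [map_smulₛₗ, hi]
  have e3 : algebraMap F R 2⁻¹ + algebraMap F R 2⁻¹ = 1 := by
    rw [← map_add, ← map_one (algebraMap F R)]
    congr 1
    field_simp
    norm_num
  apply eq_sub_of_add_eq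
  simp only [splitIdem, adjR, map_add, LinearMap.baseChange_tmul, e, adj_one, TensorProduct.tmul_neg]
  rw [add_add_add_comm, neg_add_cancel, add_zero, ← TensorProduct.add_tmul, e3]
  rfl

variable (h₁ : HermForm c W₁) (h₂ : HermForm c W₂) (h2 : (2 : F) ≠ 0) (φ : W₂ ≃ₗ[E] W₁)

/-- The section of the contraction defined by a square root `j` of `d` in `R`. -/
noncomputable def contractionSection (i : E) (d : F) (j : R) (z : R ⊗[F] herm h₁) :
    R ⊗[F] unitaryLieOne h₁ h₂ :=
  (lieCoordR R h₁ h₂ h2 φ).symm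
    (blend (splitIdem F W₁ i d j) (-(hermEquiv R h₁ z).1) (1 ⊗ₜ[F] gramInv h₁ h₂ φ))

theorem lieCoordR_contractionSection (i : E) (d : F) (j : R) (z : R ⊗[F] herm h₁) :
    lieCoordR R h₁ h₂ h2 φ (contractionSection R h₁ h₂ h2 φ i d j z) =
      blend (splitIdem F W₁ i d j) (-(hermEquiv R h₁ z).1) (1 ⊗ₜ[F] gramInv h₁ h₂ φ) :=
  LinearEquiv.apply_symm_apply _ _

theorem lieCoordR_mapScalars {S : Type u} [CommRing S] [Algebra F S] (f : S →ₐ[F] R)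
    (x : S ⊗[F] unitaryLieOne h₁ h₂) :
    lieCoordR R h₁ h₂ h2 φ (mapScalars f _ x) = mapScalars f _ (lieCoordR S h₁ h₂ h2 φ x) := by
  rw [lieCoordR_eq_baseChange, lieCoordR_eq_baseChange, mapScalars_baseChange]

theorem contractionSection_mapScalars {S : Type u} [CommRing S] [Algebra F S] (f : S →ₐ[F] R)
    (i : E) (d : F) (j : S) (z : S ⊗[F] herm h₁) :
    contractionSection R h₁ h₂ h2 φ i d (f j) (mapScalars f _ z) =
      mapScalars f _ (contractionSection S h₁ h₂ h2 φ i d j z) := by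
  apply (lieCoordR R h₁ h₂ h2 φ).injective
  have hz : (hermEquiv R h₁ (mapScalars f _ z)).1 = mapScalars f _ (hermEquiv S h₁ z).1 :=
    (mapScalars_baseChange f _ z).symm
  have hsub : mapScalars f (Module.End E W₁) (1 - splitIdem F W₁ i d j) =
      1 - splitIdem F W₁ i d (f j) := by
    have := map_sub (Algebra.TensorProduct.map f (AlgHom.id F (Module.End E W₁))) 1
      (splitIdem F W₁ i d j)
    rw [map_one] at this
    exact this.trans (congrArg (1 - ·) (mapScalars_splitIdem i d f j))
  have hneg : mapScalars f (Module.End E W₁) (-(hermEquiv S h₁ z).1) =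
      -mapScalars f _ (hermEquiv S h₁ z).1 := map_neg _ _
  rw [lieCoordR_mapScalars, lieCoordR_contractionSection, lieCoordR_contractionSection, blend,
    blend, map_add, mapScalars_mul, mapScalars_mul, mapScalars_splitIdem, hsub, hneg, hz,
    mapScalars_tmul, map_one]

theorem adjR_blend (h2 : (2 : F) ≠ 0) {i : E} (hci : c i = -i) (d : F) (j : R)
    (a b : R ⊗[F] Module.End E W₁) :
    adjR R h₁ h₁ (blend (splitIdem F W₁ i d j) a b) =
      blend (splitIdem F W₁ i d j) (adjR R h₁ h₁ b) (adjR R h₁ h₁ a) :=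
  map_blend_of_antihom (splitIdem_mul_comm R i d j) _ (map_add _) (adjR_mul R h₁)
    (adjR_splitIdem R h₁ h2 hci d j)
    (by rw [← adjR_splitIdem R h₁ h2 hci d j, adjR_adjR]) a b

variable {i : E} {d : F} {j : R}

/-- The section is indeed a section of the contraction. -/
theorem contractionR_contractionSection (hi : i * i = algebraMap F E d) (hci : c i = -i)
    (hd : d ≠ 0) (hj : j * j = algebraMap F R d) (z : R ⊗[F] herm h₁) :
    contractionR R h₁ h₂ (contractionSection R h₁ h₂ h2 φ i d j z) = z := by
  apply (hermEquiv R h₁).injective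
  apply Subtype.ext
  have he := splitIdem_mul_self (W₁ := W₁) R h2 hd hi hj
  have hc := splitIdem_mul_comm (W₁ := W₁) R i d j
  have hM : adjR R h₁ h₁ (-(hermEquiv R h₁ z).1) = -(hermEquiv R h₁ z).1 := by
    rw [map_neg, (hermEquiv R h₁ z).2]
  -- Componentwise, `P H P*` is `(-z) H H⁻¹` on one factor and `H⁻¹ H (-z)` on the other, so it
  -- equals `-z`.
  rw [hermEquiv_contractionR R h₁ h₂ h2 φ, lieCoordR_contractionSection, adjR_blend R h₁ h2 hci,
    adjR_gramInv, hM, blend_mul he hc, blend_mul_blend he hc, mul_assoc, tmul_gram_mul_gramInv,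
    tmul_gramInv_mul_gram, mul_one, one_mul, blend_self]
  exact neg_neg _

/-- If the coordinate of `x` is invertible, then `x` is conjugate under `U(W₂)` to the value of
the section at the contraction of `x`. -/
theorem exists_lieAct_eq_contractionSection (hi : i * i = algebraMap F E d) (hci : c i = -i)
    (hd : d ≠ 0) (hj : j * j = algebraMap F R d) (x : R ⊗[F] unitaryLieOne h₁ h₂)
    (hx : IsUnit (lieCoordR R h₁ h₂ h2 φ x)) :
    ∃ h : unitaryGroup R h₂, lieAct R h₁ h₂ (1, h) x =
      contractionSection R h₁ h₂ h2 φ i d j (contractionR R h₁ h₂ x) := by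
  have he := splitIdem_mul_self (W₁ := W₁) R h2 hd hi hj
  have hc := splitIdem_mul_comm (W₁ := W₁) R i d j
  obtain ⟨u, hu⟩ := hx
  let e := splitIdem F W₁ i d j
  let H : R ⊗[F] Module.End E W₁ := 1 ⊗ₜ[F] gram h₁ h₂ φ
  let H' : R ⊗[F] Module.End E W₁ := 1 ⊗ₜ[F] gramInv h₁ h₂ φ
  let P : R ⊗[F] Module.End E W₁ := u
  let Q : R ⊗[F] Module.End E W₁ := (u⁻¹ : (R ⊗[F] Module.End E W₁)ˣ)
  let s := adjR R h₁ h₁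
  have hPQ : P * Q = 1 := u.mul_inv
  have hQP : Q * P = 1 := u.inv_mul
  have hHH' : H * H' = 1 := tmul_gram_mul_gramInv R h₁ h₂ φ
  have hH'H : H' * H = 1 := tmul_gramInv_mul_gram R h₁ h₂ φ
  have hsH : s H = H := adjR_gram R h₁ h₂ φ
  have hsH' : s H' = H' := adjR_gramInv R h₁ h₂ φ
  have hsmul : ∀ a b, s (a * b) = s b * s a := adjR_mul R h₁
  have hss : ∀ a, s (s a) = a := adjR_adjR R h₁ h₁
  have hsQP : s Q * s P = 1 := by rw [← hsmul, hPQ]; exact adjR_one R h₁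
  have hsPQ : s P * s Q = 1 := by rw [← hsmul, hQP]; exact adjR_one R h₁
  have cancel : ∀ a b : R ⊗[F] Module.End E W₁, a * b = 1 → ∀ t, a * (b * t) = t := by
    intro a b hab t
    rw [← mul_assoc, hab, one_mul]
  -- The action sends `P` to `P k⁻¹`. The inverse `k'` is chosen so that `P k'` has components `P H
  -- P*` and `H⁻¹`, the coordinates of the section at `r(x) = -P H P*`. Unitarity is no obstruction:
  -- it only ties the component of `k` on one factor to its component on the other.
  let k := blend e (s Q * H') (H * P)
  let k' := blend e (H * s P) (Q * H')
  have hkk' : k * k' = 1 := by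
    rw [blend_mul_blend he hc, mul_assoc, mul_assoc, cancel _ _ hH'H, cancel _ _ hPQ, hsQP, hHH',
      blend_self]
  have hk'k : k' * k = 1 := by
    rw [blend_mul_blend he hc, mul_assoc, mul_assoc, cancel _ _ hsPQ, cancel _ _ hH'H, hQP, hHH',
      blend_self]
  have hsk : s k = blend e (s P * H) (H' * Q) := by
    rw [show s k = _ from adjR_blend R h₁ h2 hci d j _ _]
    change blend e (s (H * P)) (s (s Q * H')) = _
    rw [hsmul, hsmul, hss, hsH, hsH']
  -- This is `k H k* = H`, written with the transported adjoint of `conjR_adjR`.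
  have hk : k * (H * s k * H') = 1 := by
    rw [hsk, mul_blend he hc, blend_mul he hc H', blend_mul_blend he hc]
    simp only [mul_assoc]
    rw [hHH', mul_one, cancel _ _ hH'H, hsQP, cancel _ _ hHH', cancel _ _ hPQ, hHH', blend_self]
  let h₀ : (R ⊗[F] Module.End E W₂)ˣ :=
    Units.map (conjR R φ).symm.toAlgHom.toRingHom.toMonoidHom ⟨k, k', hkk', hk'k⟩
  have hh₀ : (h₀ : R ⊗[F] Module.End E W₂) = (conjR R φ).symm k := rfl
  have hh₀' : ((h₀⁻¹ : (R ⊗[F] Module.End E W₂)ˣ) : R ⊗[F] Module.End E W₂) =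
      (conjR R φ).symm k' := rfl
  have hmem : h₀ ∈ unitaryGroup R h₂ := by
    change (h₀ : R ⊗[F] Module.End E W₂) * adjR R h₂ h₂ h₀ = 1
    apply (conjR R φ).injective
    rw [map_mul, conjR_adjR R h₁ h₂, map_one, hh₀, AlgEquiv.apply_symm_apply]
    exact hk
  refine ⟨⟨h₀, hmem⟩, ?_⟩
  apply (lieCoordR R h₁ h₂ h2 φ).injective
  rw [lieCoordR_lieAct, lieCoordR_contractionSection, hermEquiv_contractionR R h₁ h₂ h2 φ, ← hu]
  have e1 : conjR R φ (((⟨h₀, hmem⟩ : unitaryGroup R h₂)⁻¹ : unitaryGroup R h₂) :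
      (R ⊗[F] Module.End E W₂)ˣ) = k' := by
    change conjR R φ ((h₀⁻¹ : (R ⊗[F] Module.End E W₂)ˣ) : R ⊗[F] Module.End E W₂) = k'
    rw [hh₀', AlgEquiv.apply_symm_apply]
  rw [e1]
  change 1 * P * k' = blend e (-(-(P * H * s P))) H'
  have hneg : -(-(P * H * s P)) = P * H * s P := neg_neg _
  rw [hneg, one_mul, mul_blend he hc, mul_assoc, ← mul_assoc P Q, hPQ, one_mul]

end Section

/-! ### Density and descent from `E` to `F`. -/

section Descent

variable {F : Type u} [Field F]

/-- Morphisms from an integral affine scheme to a separated scheme are determined by their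
restriction along a dominant morphism. -/
theorem hom_ext_of_injective {B K : Type u} [CommRing B] [Algebra F B] [IsDomain B] [CommRing K]
    [Algebra F K] (ψ : B →ₐ[F] K) (hψ : Function.Injective ψ)
    {Z : Over (Spec (CommRingCat.of F))} [IsSeparated Z.hom] {f g : specOver F B ⟶ Z}
    (h : specOverMap ψ ≫ f = specOverMap ψ ≫ g) : f = g := by
  apply Over.OverMorphism.ext
  let q : Spec (CommRingCat.of K) ⟶ (specOver F B).left :=
    Spec.map (CommRingCat.ofHom ψ.toRingHom)
  -- The map on spectra has dense image because the kernel of `ψ` is zero. Together with reducedness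
  -- of the source and separatedness of the target this forces equality.
  have : IsDominant q := by
    constructor
    refine (PrimeSpectrum.denseRange_comap_iff_ker_le_nilRadical ψ.toRingHom).2 ?_
    rw [(RingHom.injective_iff_ker_eq_bot ψ.toRingHom).1 hψ]
    exact bot_le
  have : AlgebraicGeometry.IsReduced (specOver F B).left :=
    inferInstanceAs (AlgebraicGeometry.IsReduced (Spec (CommRingCat.of B)))
  exact ext_of_isDominant_of_isSeparated Z.hom ((Over.w f).trans (Over.w g).symm) q
    (congrArg (fun t => t.left) h)

theorem hom_ext_of_spec {T X : Scheme.{u}} {f g : T ⟶ X}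
    (h : ∀ (R : CommRingCat.{u}) (p : Spec R ⟶ T), p ≫ f = p ≫ g) : f = g :=
  Scheme.Cover.hom_ext T.affineCover _ _ fun x => h _ (T.affineCover.f x)

variable (E : Type u) [Field E] [Algebra F E] (A : Type u) [CommRing A] [Algebra F A]

variable (F) in
/-- The projection `Spec (E ⊗ A) ⟶ Spec A`. -/
noncomputable abbrev scalarProj : specOver F (E ⊗[F] A) ⟶ specOver F A :=
  specOverMap Algebra.TensorProduct.includeRight

/-- `E` is faithfully flat over the field `F`, and base change to `A` preserves this; a flat
surjective morphism of affine schemes is an effective epimorphism. -/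
theorem effectiveEpi_scalarProj : EffectiveEpi (scalarProj F E A).left := by
  let f : A →+* E ⊗[F] A :=
    (Algebra.TensorProduct.includeRight : A →ₐ[F] E ⊗[F] A).toRingHom
  have hf : f.FaithfullyFlat := by
    have h : (algebraMap A (A ⊗[F] E)).FaithfullyFlat :=
      RingHom.faithfullyFlat_algebraMap_iff.2 inferInstance
    let t := (Algebra.TensorProduct.comm F A E).toRingEquiv
    have e : f = t.toRingHom.comp (algebraMap A (A ⊗[F] E)) := RingHom.ext fun a => by
      simp [f, t, Algebra.TensorProduct.algebraMap_apply]
    rw [e]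
    exact RingHom.FaithfullyFlat.stableUnderComposition _ _ h
      (RingHom.FaithfullyFlat.of_bijective t.bijective)
  have h := (flat_and_surjective_SpecMap_iff (CommRingCat.ofHom f)).2 hf
  have := h.1
  have := h.2
  exact inferInstanceAs (EffectiveEpi (Spec.map (CommRingCat.ofHom f)))

variable {E A}

theorem scalarProj_cancel {Z : Over (Spec (CommRingCat.of F))} {f g : specOver F A ⟶ Z}
    (h : scalarProj F E A ≫ f = scalarProj F E A ≫ g) : f = g := by
  have := effectiveEpi_scalarProj (F := F) E A
  apply Over.OverMorphism.ext
  rw [← cancel_epi (scalarProj F E A).left]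
  exact congrArg (fun t => t.left) h

/-- Descent of morphisms along `Spec (E ⊗ A) ⟶ Spec A`, tested on points in affine schemes. -/
theorem exists_scalarProj_comp_eq {Z : Over (Spec (CommRingCat.of F))}
    (f : specOver F (E ⊗[F] A) ⟶ Z)
    (hf : ∀ (R : Type u) [CommRing R] [Algebra F R] (a b : E ⊗[F] A →ₐ[F] R),
      a.comp Algebra.TensorProduct.includeRight = b.comp Algebra.TensorProduct.includeRight →
      specOverMap a ≫ f = specOverMap b ≫ f) :
    ∃ g : specOver F A ⟶ Z, scalarProj F E A ≫ g = f := by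
  have := effectiveEpi_scalarProj (F := F) E A
  let ρ : A →+* E ⊗[F] A :=
    (Algebra.TensorProduct.includeRight : A →ₐ[F] E ⊗[F] A).toRingHom
  let f' : Spec (CommRingCat.of (E ⊗[F] A)) ⟶ Z.left := f.left
  -- The descent condition ranges over all test schemes; an affine cover reduces it to rings `R`,
  -- where both maps come from ring homomorphisms `a` and `b`.
  have key : ∀ {T : Scheme.{u}} (g₁ g₂ : T ⟶ Spec (CommRingCat.of (E ⊗[F] A))),
      g₁ ≫ Spec.map (CommRingCat.ofHom ρ) = g₂ ≫ Spec.map (CommRingCat.ofHom ρ) →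
        g₁ ≫ f' = g₂ ≫ f' := by
    intro T g₁ g₂ h
    apply hom_ext_of_spec
    intro R p
    obtain ⟨a, ha⟩ := Spec.map_surjective (p ≫ g₁)
    obtain ⟨b, hb⟩ := Spec.map_surjective (p ≫ g₂)
    have hab : CommRingCat.ofHom ρ ≫ a = CommRingCat.ofHom ρ ≫ b := by
      apply Spec.map_injective
      rw [Spec.map_comp, Spec.map_comp, ha, hb, Category.assoc, Category.assoc, h]
    have hab' : ∀ t, a.hom (ρ t) = b.hom (ρ t) := fun t =>
      congrArg (fun q : A →+* _ => q t) (congrArg CommRingCat.Hom.hom hab)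
    -- The ring `R` becomes an `F`-algebra through `a`. Then `b` is `F`-linear as well, because the
    -- two maps agree on `A` and so on `F`.
    let _ := (a.hom.comp (algebraMap F (E ⊗[F] A))).toAlgebra
    let a' : E ⊗[F] A →ₐ[F] R := { toRingHom := a.hom, commutes' := fun _ => rfl }
    let b' : E ⊗[F] A →ₐ[F] R :=
      { toRingHom := b.hom
        commutes' := fun r => by
          have e : algebraMap F (E ⊗[F] A) r = ρ (algebraMap F A r) :=
            (AlgHom.commutes Algebra.TensorProduct.includeRight r).symm
          change b.hom (algebraMap F (E ⊗[F] A) r) = a.hom (algebraMap F (E ⊗[F] A) r)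
          rw [e, hab'] }
    have h' := congrArg (fun t => t.left) (hf R a' b' (AlgHom.ext hab'))
    rw [← Category.assoc, ← Category.assoc, ← ha, ← hb]
    exact h'
  obtain ⟨g, hg⟩ : ∃ g : (specOver F A).left ⟶ Z.left, (scalarProj F E A).left ≫ g = f.left :=
    ⟨EffectiveEpi.desc (scalarProj F E A).left f.left key, EffectiveEpi.fac _ _ _⟩
  refine ⟨Over.homMk g ?_, Over.OverMorphism.ext hg⟩
  rw [← cancel_epi (scalarProj F E A).left, ← Category.assoc, hg, Over.w, Over.w]

/-- The ring is a polynomial ring over the field `E`. -/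
instance isDomain_tensor_symmetricAlgebra (M : Type u) [AddCommGroup M] [Module F M] :
    IsDomain (E ⊗[F] SymmetricAlgebra F M) :=
  let b := Module.Free.chooseBasis F M
  ((Algebra.TensorProduct.congr AlgEquiv.refl (SymmetricAlgebra.equivMvPolynomial b)).trans
    ((MvPolynomial.algebraTensorAlgEquiv F E).restrictScalars F)).toMulEquiv.isDomain
      (MvPolynomial _ E)

theorem exists_genericPoint_mapScalars {V : Type u} [AddCommGroup V] [Module F V]
    [FiniteDimensional F V] (R : Type u) [CommRing R] [Algebra F R] (x : R ⊗[F] V) :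
    ∃ a : SymmetricAlgebra F (Module.Dual F V) →ₐ[F] R,
      mapScalars a V (genericPoint F V) = x := by
  obtain ⟨a, ha⟩ := specOverMap_bijective.2 (points R x)
  refine ⟨a, (points R).injective ?_⟩
  rw [points_mapScalars, points_genericPoint, ha]
  exact Category.comp_id _

variable (F E) in
/-- Over the extension `E` of `F` there is a universal point of the affine space of `V`, with
values in a domain; morphisms out of the affine space can be descended along it. -/
theorem exists_universal_point (V : Type u) [AddCommGroup V] [Module F V]
    [FiniteDimensional F V] :
    ∃ (B : Type u) (_ : CommRing B) (_ : Algebra F B) (_ : IsDomain B) (κ₀ : E →ₐ[F] B)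
      (x₀ : B ⊗[F] V),
      (∀ (R : Type u) [CommRing R] [Algebra F R] (κ : E →ₐ[F] R) (x : R ⊗[F] V),
        ∃ a : B →ₐ[F] R, mapScalars a V x₀ = x ∧ ∀ t, a (κ₀ t) = κ t) ∧
      (∀ (Z : Over (Spec (CommRingCat.of F))) (f g : affineSpace F V ⟶ Z),
        points B x₀ ≫ f = points B x₀ ≫ g → f = g) ∧
      (∀ (Z : Over (Spec (CommRingCat.of F))) (f : specOver F B ⟶ Z),
        (∀ (R : Type u) [CommRing R] [Algebra F R] (a b : B →ₐ[F] R),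
          mapScalars a V x₀ = mapScalars b V x₀ → specOverMap a ≫ f = specOverMap b ≫ f) →
        ∃ g : affineSpace F V ⟶ Z, points B x₀ ≫ g = f) := by
  have hx₀ : points _ (mapScalars (Algebra.TensorProduct.includeRight :
      _ →ₐ[F] E ⊗[F] SymmetricAlgebra F (Module.Dual F V)) V (genericPoint F V)) =
      scalarProj F E _ := by
    rw [points_mapScalars, points_genericPoint]
    exact Category.comp_id _
  refine ⟨E ⊗[F] SymmetricAlgebra F (Module.Dual F V), inferInstance, inferInstance,
    inferInstance, Algebra.TensorProduct.includeLeft,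
    mapScalars Algebra.TensorProduct.includeRight V (genericPoint F V), ?_, ?_, ?_⟩
  · intro R _ _ κ x
    obtain ⟨a, ha⟩ := exists_genericPoint_mapScalars R x
    refine ⟨Algebra.TensorProduct.lift κ a fun _ _ => Commute.all _ _, ?_, fun t => ?_⟩
    · rw [← mapScalars_comp, ← ha]
      congr 2
      ext
      simp
    · simp
  · intro Z f g h
    rw [hx₀] at h
    exact scalarProj_cancel h
  · intro Z f hf
    rw [hx₀]
    apply exists_scalarProj_comp_eq
    intro R _ _ a b hab
    apply hf
    rw [← mapScalars_comp, ← mapScalars_comp, hab]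

theorem exists_injective_to_field (B : Type u) [CommRing B] [Algebra F B] [IsDomain B] :
    ∃ (K : Type u) (_ : Field K) (_ : Algebra F K) (ψ : B →ₐ[F] K), Function.Injective ψ :=
  ⟨FractionRing B, inferInstance, inferInstance, IsScalarTower.toAlgHom F B (FractionRing B),
    IsFractionRing.injective B (FractionRing B)⟩

end Descent

/-! ### The universal property of the contraction. -/

section Quotient

variable {F E : Type u} [Field F] [Field E] [Algebra F E]
variable {c : E ≃ₐ[F] E}
variable {W₁ : Type u} [AddCommGroup W₁] [Module E W₁] [Module F W₁] [IsScalarTower F E W₁]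
variable {W₂ : Type u} [AddCommGroup W₂] [Module E W₂] [Module F W₂] [IsScalarTower F E W₂]
variable [Algebra.IsQuadraticExtension F E] [FiniteDimensional E W₁] [FiniteDimensional E W₂]
variable (h₁ : HermForm c W₁) (h₂ : HermForm c W₂) (h2 : (2 : F) ≠ 0) (φ : W₂ ≃ₗ[E] W₁)

/-- An invariant morphism is unchanged when a point with values in an `E`-algebra is replaced by
the value of the section at its contraction. -/
theorem points_comp_eq_of_isInvariant {i : E} {d : F} (hi : i * i = algebraMap F E d)
    (hci : c i = -i) (hd : d ≠ 0) {Z : Over (Spec (CommRingCat.of F))} [IsSeparated Z.hom]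
    (f : affineSpace F (unitaryLieOne h₁ h₂) ⟶ Z)
    (hf : IsInvariant
      (fun R _ _ (h : unitaryGroup R h₂) => schemeLieAct h₁ h₂ R (1, h)) f)
    (R : Type u) [CommRing R] [Algebra F R] (ι : E →ₐ[F] R) (x : R ⊗[F] unitaryLieOne h₁ h₂) :
    points R (contractionSection R h₁ h₂ h2 φ i d (ι i) (contractionR R h₁ h₂ x)) ≫ f =
      points R x ≫ f := by
  obtain ⟨B, _, _, _, κ₀, x₀, lift_exists, -, -⟩ :=
    exists_universal_point F E (unitaryLieOne h₁ h₂)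
  have nat : ∀ (U : Type u) [CommRing U] [Algebra F U] (a : B →ₐ[F] U),
      points (V := unitaryLieOne h₁ h₂) U (contractionSection U h₁ h₂ h2 φ i d (a (κ₀ i))
        (contractionR U h₁ h₂ (mapScalars a _ x₀))) =
      specOverMap a ≫ points (V := unitaryLieOne h₁ h₂) B
        (contractionSection B h₁ h₂ h2 φ i d (κ₀ i) (contractionR B h₁ h₂ x₀)) := by
    intro U _ _ a
    rw [← points_mapScalars, ← contractionSection_mapScalars, contractionR_natural]
  have main : points B (contractionSection B h₁ h₂ h2 φ i d (κ₀ i) (contractionR B h₁ h₂ x₀)) ≫ f =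
      points B x₀ ≫ f := by
    obtain ⟨K, _, _, ψ, hψ⟩ := exists_injective_to_field (F := F) B
    -- Separatedness of `Z` enters here: it suffices to compare at the generic point of the integral
    -- scheme `Spec B`.
    apply hom_ext_of_injective ψ hψ
    rw [← Category.assoc, ← Category.assoc, ← nat, ← points_mapScalars]
    have hunit : IsUnit (lieCoordR K h₁ h₂ h2 φ (mapScalars ψ _ x₀)) := by
      rw [lieCoordR_mapScalars]
      -- The universal coordinate specialises to the identity operator, that is to `X = φ`, so it is
      -- invertible over the field `K`.
      obtain ⟨a, ha, -⟩ := lift_exists E (AlgHom.id F E) ((lieCoordR E h₁ h₂ h2 φ).symm 1)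
      have : FiniteDimensional F (Module.End E W₁) := Module.Finite.trans E (Module.End E W₁)
      apply isUnit_mapScalars_of_specialization _ a ψ hψ
      rw [← lieCoordR_mapScalars, ha, LinearEquiv.apply_symm_apply]
      exact isUnit_one
    have hj : ψ (κ₀ i) * ψ (κ₀ i) = algebraMap F K d := by
      rw [← map_mul, ← map_mul, hi, AlgHom.commutes, AlgHom.commutes]
    obtain ⟨h, hh⟩ := exists_lieAct_eq_contractionSection K h₁ h₂ h2 φ hi hci hd hj _ hunit
    rw [← hh, ← hf K h (points K (mapScalars ψ _ x₀))]
    simp only [schemeLieAct, Equiv.symm_apply_apply]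
  -- Every pair of a map `E → R` and a point over `R` is a specialisation of the universal one, and
  -- so inherits the identity.
  obtain ⟨a, ha, hai⟩ := lift_exists R ι x
  rw [← ha, ← hai, nat, points_mapScalars, Category.assoc, Category.assoc, main]

/-- The contraction is a categorical quotient. -/
theorem isCategoricalQuotient_contraction (h2 : (2 : F) ≠ 0) (φ : W₂ ≃ₗ[E] W₁)
    (hc : c ≠ AlgEquiv.refl) :
    IsCategoricalQuotient (fun R _ _ (h : unitaryGroup R h₂) => schemeLieAct h₁ h₂ R (1, h))
      (contraction h₁ h₂) := by
  obtain ⟨i, d, hi, hci, hd⟩ := exists_imaginary h2 hc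
  refine ⟨?_, ?_⟩
  · intro R _ _ h x
    obtain ⟨y, rfl⟩ := (points R).surjective x
    simp only [schemeLieAct, Equiv.symm_apply_apply]
    rw [points_contraction, points_contraction, contractionR_lieAct_snd R h₁ h₂ h h2 φ]
  intro Z _ f hf
  have star := points_comp_eq_of_isInvariant h₁ h₂ h2 φ hi hci hd f hf
  obtain ⟨B, _, _, -, κ₀, z₀, lift_z, cancel_z, desc_z⟩ := exists_universal_point F E (herm h₁)
  have hj : ∀ (R : Type u) [CommRing R] [Algebra F R] (κ : E →ₐ[F] R),
      κ i * κ i = algebraMap F R d := by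
    intro R _ _ κ
    rw [← map_mul, hi, AlgHom.commutes]
  have hs₀ : points B (contractionSection B h₁ h₂ h2 φ i d (κ₀ i) z₀) ≫ contraction h₁ h₂ =
      points B z₀ := by
    rw [points_contraction, contractionR_contractionSection B h₁ h₂ h2 φ hi hci hd (hj B κ₀)]
  obtain ⟨g, hg⟩ := desc_z Z
    (points B (contractionSection B h₁ h₂ h2 φ i d (κ₀ i) z₀) ≫ f) (by
      intro R _ _ a b hab
      -- The section formed with the embedding from `a` is applied to the contraction of the section
      -- point formed with `b`. That contraction is the common value `z`, so `f` takes the same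
      -- value on both section points.
      have e := star R (a.comp κ₀)
        (contractionSection R h₁ h₂ h2 φ i d (b (κ₀ i)) (mapScalars b _ z₀))
      rw [contractionR_contractionSection R h₁ h₂ h2 φ hi hci hd
        (j := b (κ₀ i)) (hj R (b.comp κ₀))] at e
      rw [← Category.assoc, ← Category.assoc, ← points_mapScalars, ← points_mapScalars,
        ← contractionSection_mapScalars, ← contractionSection_mapScalars, hab]
      exact e)
  refine ⟨g, ?_, ?_⟩
  · obtain ⟨B', _, _, -, κ', x₀, -, cancel_x, -⟩ :=
      exists_universal_point F E (unitaryLieOne h₁ h₂)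
    -- It suffices to check `f = g ∘ r` at the universal point `x₀`, where `f(x₀) = f(s(r(x₀)))`;
    -- the right side is a specialisation of the identity defining `g`.
    apply cancel_x
    obtain ⟨a, ha, hai⟩ := lift_z B' κ' (contractionR B' h₁ h₂ x₀)
    rw [← star B' κ' x₀, ← Category.assoc, points_contraction, ← ha, ← hai,
      contractionSection_mapScalars, points_mapScalars, points_mapScalars, Category.assoc,
      Category.assoc, hg]
  · intro g' hg'
    -- Any factorisation takes the value `f(s(z₀))` at the universal point `z₀`, because `r(s(z₀)) =
    -- z₀`.
    apply cancel_z
    rw [hg, ← hs₀, Category.assoc, hg']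

end Quotient

end UnitarySymmetricPair

open UnitarySymmetricPair

theorem mainTheorem6 {F E : Type u} [Field F] [Field E] [Algebra F E]
    [Algebra.IsQuadraticExtension F E] (h2 : (2 : F) ≠ 0)
    (c : E ≃ₐ[F] E) (hc : c ≠ AlgEquiv.refl)
    {W₁ : Type u} [AddCommGroup W₁] [Module E W₁] [Module F W₁] [IsScalarTower F E W₁]
    [FiniteDimensional E W₁]
    {W₂ : Type u} [AddCommGroup W₂] [Module E W₂] [Module F W₂] [IsScalarTower F E W₂]
    [FiniteDimensional E W₂]
    (hd : Module.finrank E W₁ = Module.finrank E W₂)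
    (h₁ : HermForm c W₁) (h₂ : HermForm c W₂) :
    (∀ (R : Type u) [CommRing R] [Algebra F R] (g : unitaryGroup R h₁)
        (x : specOver F R ⟶ affineSpace F (unitaryLieOne h₁ h₂)),
      schemeLieAct h₁ h₂ R (g, 1) x ≫ contraction h₁ h₂ =
        schemeHermAct h₁ R g (x ≫ contraction h₁ h₂)) ∧
    IsCategoricalQuotient (fun R _ _ (h : unitaryGroup R h₂) => schemeLieAct h₁ h₂ R (1, h))
      (contraction h₁ h₂) := by
  let φ : W₂ ≃ₗ[E] W₁ := LinearEquiv.ofFinrankEq W₂ W₁ hd.symm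
  refine ⟨?_, isCategoricalQuotient_contraction h₁ h₂ h2 φ hc⟩
  intro R _ _ g x
  obtain ⟨y, rfl⟩ := (points R).surjective x
  rw [points_contraction, schemeLieAct, schemeHermAct, Equiv.symm_apply_apply,
    Equiv.symm_apply_apply, points_contraction, contractionR_lieAct_fst R h₁ h₂ g h2 φ]
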